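/- Let $H_1$ be a separable real Hilbert space, let $C[0,1]$ carry the supremum norm $\|\cdot\|_\infty$, let $\varrho\colon H_1\to C[0,1]$ be a bounded linear operator, and let $$Y_k=\varrho(X_k)+\varepsilon_k,\qquad k\in\mathbb Z,$$ where $X_k$ and $\varepsilon_k$ are random elements of $H_1$ and $C[0,1]$ on a common probability space. Assume: 1. $EX_k=0$ and $(X_k)$ is $L^4$-$m$-approximable: $E\|X_k\|^4<\infty$; $X_k=f(e_k,e_{k-1},\dots)$ a.s. for i.i.d. random elements $(e_i)_{i\in\mathbb Z}$ of some measurable space and a measurable $f$; and $\sum_{m\ge1}\big(E\|X_m-X_m^{(m)}\|^4\big)^{1/4}<\infty$, where $X_m^{(m)}=f(e_m,\dots,e_1,e_0',e_{-1}',\dots)$ with an independent copy $(e_i')$ of $(e_i)$. 2. $(\varepsilon_k)$ is i.i.d. with $E\varepsilon_k=0$ and $E\|\varepsilon_k\|_\infty^4<\infty$, and for every $k$ the error $\varepsilon_k$ is independent of the family formed by $(X_j)_{j\le k}$ and $(\varepsilon_j)_{j<k}$ jointly. 3. For some $0<\alpha\le1$ and every $k$, almost surely $|\varepsilon_k(t)-\varepsilon_k(s)|<M_k|t-s|^\alpha$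 for all $s\ne t$ in $[0,1]$, where $M_k$ is a positive random variable independent of $X_k$ with $EM_k^2<\infty$. Let $\widehat C_{XX}=\frac1n\sum_{k=1}^nX_k\otimes X_k$ and $\widehat C_{YX}=\frac1n\sum_{k=1}^nY_k\otimes X_k$, where $(a\otimes b)(x)=\langle b,x\rangle a$. Let $\hat\lambda_1\ge\hat\lambda_2\ge\dots\ge0$ be the eigenvalues of $\widehat C_{XX}$, repeated according to multiplicity, and $\hat v_1,\hat v_2,\dots$ any corresponding orthonormal eigenvectors. Let $m_n\to\infty$ with $m_n=o(n^{\alpha/2})$, let $T_n=\max\{j\ge1:\hat\lambda_j\ge m_n^{-1}\}$ ($T_n=0$ if there is no such $j$), and define $$\hat\varrho_n(x)=\sum_{i=1}^{T_n}\frac1{\hat\lambda_i}\,\langle\hat v_i,x\rangle\,\widehat C_{YX}\hat v_i .$$ Then $\hat\varrho_n$ is consistent in supremum norm out of sample and in sample: (a) if $X$ has the distribution of $X_1$ and is, for every $n$, independent of the sample $(Y_1,X_1),\dots,(Y_n,X_n)$, then $\|\hat\varrho_n(X)-\varrho(X)\|_\infty\to0$ in probability as $n\to\infty$; (b) if, for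 every $n$, $K_n$ is uniformly distributed on $\{1,\dots,n\}$ and independent of the sample $(Y_1,X_1),\dots,(Y_n,X_n)$, then $\|\hat\varrho_n(X_{K_n})-\varrho(X_{K_n})\|_\infty\to0$ in probability as $n\to\infty$. -/

import Mathlib

open MeasureTheory ProbabilityTheory Filter Topology Asymptotics

noncomputable section

namespace FPCA

/-- The Banach space `C[0,1]` with the supremum norm. -/
abbrev C01 : Type := C(unitInterval, ℝ)

/-- `C[0,1]` carries its Borel sigma-algebra. -/
instance : MeasurableSpace C01 := borel C01

instance : BorelSpace C01 := ⟨rfl⟩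

/-! ### Weak dependence -/

/-- The sequence whose first `m` entries are those of `x` and whose other entries are those
of `y`. -/
def couple {S : Type*} (m : ℕ) (x y : ℕ → S) : ℕ → S := fun i => if i < m then x i else y i

/-- `L^p`-`m`-approximability of a process `(X_k)` indexed by the integers, with innovations in
the measurable space `S`: the `X_k` are in `L^p`, they admit a causal representation
`X_k = f (e_k, e_{k-1}, …)` with i.i.d. innovations `e_i` and measurable `f`, and
`∑_{m ≥ 1} (E ‖X_m - X_m^{(m)}‖ ^ p) ^ (1 / p) < ∞`, where `X_m^{(m)}` arises from `X_m` when all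
innovations but the `m` most recent ones are replaced by those of an independent copy of `(e_i)`.
The joint law of the innovations `(e_0, e_{-1}, …)` and of an independent copy of them is the
product of the law of `(e_0, e_{-1}, …)` with itself; by stationarity of the innovations it does
not matter at which time index the summands are evaluated. -/
def IsLpMApproximable (S : Type*) [MeasurableSpace S] {Ω H : Type*} [MeasurableSpace Ω]
    [NormedAddCommGroup H] [MeasurableSpace H] (p : ENNReal) (μ : Measure Ω)
    (X : ℤ → Ω → H) : Prop :=
  (∀ k, MemLp (X k) p μ) ∧
  ∃ (e : ℤ → Ω → S) (f : (ℕ → S) → H),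
    (∀ i, Measurable (e i)) ∧ iIndepFun e μ ∧ (∀ i, IdentDistrib (e i) (e 0) μ μ) ∧
    Measurable f ∧
    (∀ k, ∀ᵐ ω ∂μ, X k ω = f (fun i : ℕ => e (k - i) ω)) ∧
    ∑' m : ℕ, eLpNorm (fun z : (ℕ → S) × (ℕ → S) => f z.1 - f (couple (m + 1) z.1 z.2)) p
      ((μ.map fun ω (i : ℕ) => e (-(i : ℤ)) ω).prod (μ.map fun ω (i : ℕ) => e (-(i : ℤ)) ω)) < ⊤

/-! ### Hölder errors -/

/-- The errors are almost surely Hölder continuous of order `α`, with positive random constants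
`M_k` that have a finite second moment and are independent of `X_k`. -/
def HolderErrors {Ω H : Type*} [MeasurableSpace Ω] [MeasurableSpace H] (μ : Measure Ω)
    (X : ℤ → Ω → H) (ε : ℤ → Ω → C01) (α : ℝ) : Prop :=
  ∃ M : ℤ → Ω → ℝ,
    (∀ k, Measurable (M k)) ∧ (∀ k ω, 0 < M k ω) ∧ (∀ k, IndepFun (M k) (X k) μ) ∧
    (∀ k, Integrable (fun ω => M k ω ^ 2) μ) ∧
    ∀ k, ∀ᵐ ω ∂μ, ∀ s t : unitInterval, s ≠ t →
      |ε k ω t - ε k ω s| < M k ω * |(t : ℝ) - (s : ℝ)| ^ α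

/-! ### The estimator -/

section Estimator

variable {H E : Type*} [NormedAddCommGroup H] [InnerProductSpace ℝ H]
  [NormedAddCommGroup E] [NormedSpace ℝ E]

/-- The empirical (cross-)covariance operator `n⁻¹ ∑_{k=1}^n y_k ⊗ x_k`, where
`(a ⊗ b) z = ⟪b, z⟫ a`. -/
def empCov (n : ℕ) (y : ℤ → E) (x : ℤ → H) : H →L[ℝ] E :=
  (n : ℝ)⁻¹ • ∑ k ∈ Finset.Icc 1 n, InnerProductSpace.rankOne ℝ (y (k : ℤ)) (x (k : ℤ))

/-- `lam 0 ≥ lam 1 ≥ …` are the eigenvalues of the non-negative operator `C`, repeated according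
to multiplicity, and `v 0, v 1, …` are corresponding orthonormal eigenvectors. (Orthonormality is
asked for at non-zero eigenvalues only, so that finite-dimensional spaces are covered: there both
sequences can be continued by zeros.) The last clause says that no non-zero eigenvalue has been
left out. -/
structure IsEigensystem (C : H →L[ℝ] H) (lam : ℕ → ℝ) (v : ℕ → H) : Prop where
  nonneg : ∀ i, 0 ≤ lam i
  antitone : Antitone lam
  eigen : ∀ i, C (v i) = lam i • v i
  orthonormal : Orthonormal ℝ (fun i : {i : ℕ // lam i ≠ 0} => v i)
  expansion : ∀ x, HasSum (fun i => (lam i * inner ℝ (v i) x) • v i) (C x)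

/-- The empirical covariance operator always has an eigensystem. -/
theorem exists_isEigensystem_empCov (n : ℕ) (x : ℤ → H) :
    ∃ lam v, IsEigensystem (empCov n x x) lam v := by
  classical
  set C : H →L[ℝ] H := empCov n x x with hC
  have hCx : ∀ z, C z = (n : ℝ)⁻¹ • ∑ k ∈ Finset.Icc 1 n, (inner ℝ (x (k : ℤ)) z) • x (k : ℤ) := by
    intro z
    simp [hC, empCov]
  have hsymm : ∀ y z, inner ℝ (C y) z = inner ℝ y (C z) := by
    intro y z
    simp only [hCx, inner_smul_left, inner_smul_right, sum_inner, inner_sum]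
    congr 1
    refine Finset.sum_congr rfl fun k _ => ?_
    rw [real_inner_comm y]
    simp [mul_comm]
  have hpos : ∀ z, 0 ≤ inner ℝ z (C z) := by
    intro z
    simp only [hCx, inner_smul_right, inner_sum]
    refine mul_nonneg (by positivity) (Finset.sum_nonneg fun k _ => ?_)
    rw [real_inner_comm]
    exact mul_self_nonneg _
  let R : Submodule ℝ H := Submodule.span ℝ ((fun k : ℕ => x (k : ℤ)) '' (Finset.Icc 1 n : Set ℕ))
  have : FiniteDimensional ℝ R :=
    FiniteDimensional.span_of_finite ℝ ((Finset.finite_toSet _).image _)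
  have hR : ∀ z, C z ∈ R := by
    intro z
    rw [hCx]
    refine R.smul_mem _ (R.sum_mem fun k hk => R.smul_mem _ (Submodule.subset_span ?_))
    exact ⟨k, by simpa using hk, rfl⟩
  let T : R →ₗ[ℝ] R := (C : H →ₗ[ℝ] H).restrict (fun z _ => hR z)
  have hT : T.IsSymmetric := fun y z => hsymm y z
  let d := Module.finrank ℝ R
  let ev : Fin d → ℝ := hT.eigenvalues rfl
  let b : OrthonormalBasis (Fin d) ℝ R := hT.eigenvectorBasis rfl
  have hb : ∀ i, C (b i) = ev i • (b i : H) := by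
    intro i
    exact congrArg (Subtype.val) (hT.apply_eigenvectorBasis rfl i)
  have hbn : ∀ i j, inner ℝ (b i : H) (b j : H) = if i = j then (1 : ℝ) else 0 := fun i j =>
    (orthonormal_iff_ite.mp b.orthonormal) i j
  have hev : ∀ i, 0 ≤ ev i := by
    intro i
    have h := hpos (b i)
    rw [hb, inner_smul_right, hbn] at h
    simpa using h
  refine ⟨fun i => if h : i < d then ev ⟨i, h⟩ else 0,
    fun i => if h : i < d then (b ⟨i, h⟩ : H) else 0, ?_, ?_, ?_, ?_, ?_⟩
  · intro i
    by_cases h : i < d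
    · simpa [h] using hev _
    · simp [h]
  · intro i j hij
    by_cases hj : j < d
    · have hi : i < d := lt_of_le_of_lt hij hj
      simpa [hi, hj] using hT.eigenvalues_antitone rfl (show (⟨i, hi⟩ : Fin d) ≤ ⟨j, hj⟩ from hij)
    · by_cases hi : i < d
      · simpa [hi, hj] using hev _
      · simp [hi, hj]
  · intro i
    by_cases h : i < d
    · simpa [h] using hb _
    · simp [h]
  · rw [orthonormal_iff_ite]
    rintro ⟨i, hi⟩ ⟨j, hj⟩
    have hi' : i < d := by
      by_contra h
      simp [h] at hi
    have hj' : j < d := by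
      by_contra h
      simp [h] at hj
    simp [hi', hj', hbn]
  · intro z
    have hsum : C z = ∑ i ∈ Finset.range d, ((if h : i < d then ev ⟨i, h⟩ else 0) *
        inner ℝ (if h : i < d then (b ⟨i, h⟩ : H) else 0) z) •
        (if h : i < d then (b ⟨i, h⟩ : H) else 0) := by
      rw [Finset.sum_range]
      have h := congrArg (Subtype.val) (b.sum_repr' ⟨C z, hR z⟩)
      simp only [Submodule.coe_sum, Submodule.coe_smul, Submodule.coe_inner] at h
      rw [← h]
      refine Finset.sum_congr rfl fun i _ => ?_
      rw [← hsymm, hb, inner_smul_left]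
      simp
    rw [hsum]
    refine hasSum_sum_of_ne_finset_zero fun i hi => ?_
    have hi' : ¬ i < d := by simpa using hi
    simp [hi']

/-- The truncation level `max {j ≥ 1 : λ_j ≥ 1 / m}`, where `λ_j = lam (j - 1)`; it is `0` if
there is no such `j`. -/
def truncation (m : ℝ) (lam : ℕ → ℝ) : ℕ := sSup {j : ℕ | ∃ i, j = i + 1 ∧ m⁻¹ ≤ lam i}

/-- The functional principal component estimator
`∑_{i=1}^T λ_i⁻¹ • C_yx ∘ (v_i ⊗ v_i)` with `C_yx = n⁻¹ ∑_{k=1}^n y_k ⊗ x_k` and `T` the truncation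
level for the tuning parameter `m`. -/
def estimator (n : ℕ) (y : ℤ → E) (x : ℤ → H) (m : ℝ) (lam : ℕ → ℝ) (v : ℕ → H) : H →L[ℝ] E :=
  ∑ i ∈ Finset.range (truncation m lam),
    (lam i)⁻¹ • (empCov n y x).comp (InnerProductSpace.rankOne ℝ (v i) (v i))

end Estimator

/-! ### Consistency of the predictions -/

section Consistency

variable {Ω H : Type*} [MeasurableSpace Ω] [NormedAddCommGroup H] [InnerProductSpace ℝ H]
  [MeasurableSpace H]

/-- The sample `(Y_1, X_1), …, (Y_n, X_n)`. -/
def sample (Y : ℤ → Ω → C01) (X : ℤ → Ω → H) (n : ℕ) (ω : Ω) : Fin n → C01 × H :=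
  fun k => (Y ((k : ℕ) + 1) ω, X ((k : ℕ) + 1) ω)

/-- Out-of-sample consistency: if `X'` is distributed as `X_1` and independent of the sample, then
`‖ρ_n(X') - ρ(X')‖ → 0` in probability. -/
def OutOfSampleConsistent (μ : Measure Ω) (Y : ℤ → Ω → C01) (X : ℤ → Ω → H) (ρ : H →L[ℝ] C01)
    (ρhat : ℕ → Ω → H →L[ℝ] C01) : Prop :=
  ∀ X' : Ω → H, Measurable X' → IdentDistrib X' (X 1) μ μ →
    (∀ n, IndepFun X' (sample Y X n) μ) →
    TendstoInMeasure μ (fun n ω => ‖ρhat n ω (X' ω) - ρ (X' ω)‖) atTop (fun _ => 0)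

/-- In-sample consistency: if `K_n` is uniformly distributed on `{1, …, n}` and independent of the
sample, then `‖ρ_n(X_{K_n}) - ρ(X_{K_n})‖ → 0` in probability. -/
def InSampleConsistent (μ : Measure Ω) (Y : ℤ → Ω → C01) (X : ℤ → Ω → H) (ρ : H →L[ℝ] C01)
    (ρhat : ℕ → Ω → H →L[ℝ] C01) : Prop :=
  ∀ K : ℕ → Ω → ℕ, (∀ n, Measurable (K n)) →
    (∀ n, 1 ≤ n → ∀ k ∈ Finset.Icc 1 n, μ {ω | K n ω = k} = (n : ENNReal)⁻¹) →
    (∀ n, IndepFun (K n) (sample Y X n) μ) →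
    TendstoInMeasure μ (fun n ω => ‖ρhat n ω (X (K n ω) ω) - ρ (X (K n ω) ω)‖) atTop
      (fun _ => 0)

end Consistency

end FPCA

end

/-!
Write `Cₙ` for the empirical covariance operator of the covariates and `Eₙ` for the empirical
cross-covariance operator of errors and covariates, so that `empCov n Y X = ρ ∘ Cₙ + Eₙ`. The
estimator then is `ρ ∘ P + Eₙ ∘ Q`, where `P` is the spectral projection of `Cₙ` for eigenvalues at
least `1 / m_n` and `Q` the inverse of `Cₙ` on the range of `P`. There are two errors to control
(`norm_estimator_sub_le`).

*Bias.* `1 - P` is a contraction and `‖(1 - P) (Cₙ u)‖ ≤ ‖u‖ / m_n`, hence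
`‖(1 - P) x‖ ≤ ‖x - C u‖ + ‖Cₙ u - C u‖ + ‖u‖ / m_n` for each `u`, where `C` is the covariance operator
of the covariates. As a covariate almost surely lies in the closed range of `C`
(`exists_covariance_ae_mem_closure_range`), finitely many `u` make the first term small except on an
event of small probability (`exists_finite_approximation`), and for these the second one tends to `0`
in probability (`exists_integral_norm_sq_empCov_sub_le`). Thus neither spectral theory of `C` nor
convergence of empirical eigenvectors is involved. The law of large numbers rests on a coupling
(`abs_integral_inner_shift_le`): replacing all but the `k` most recent innovations by independent ones
makes a causal shift independent of its value `k` steps earlier, so autocovariances are bounded by the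
coupling distances, which are summable by `L⁴`-`m`-approximability.

*Variance.* `‖Q‖ ≤ m_n = o(n ^ (α / 2))`, so it suffices that `‖Eₙ‖` is of the order `n ^ (-α / 2)` in
mean (`exists_noise_bound`). This norm is the supremum over `t` of the norms of
`n⁻¹ ∑ ε_k(t) X_k`. For fixed `t`, and likewise for increments in `t`, the summands form martingale
differences, and chaining over dyadic points down to the scale `1 / n` gives the rate; below that
scale the Hölder condition is used directly. The given Hölder constants need not have uniformly
bounded second moments, but they dominate the Hölder seminorms of the errors, which are identically
distributed (`holderSeminorm`).

The resulting bounds depend on the argument of the prediction only through its law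
(`tendstoInMeasure_prediction`), and a covariate at an independent uniform time has the law of `X_1`
(`identDistrib_uniform_time`). So both claims are instances of the same statement.
-/

namespace FPCA

/-! ### Truncated spectral calculus of the empirical covariance operator -/

section Spectral

variable {H E : Type*} [NormedAddCommGroup H] [InnerProductSpace ℝ H]
  [NormedAddCommGroup E] [NormedSpace ℝ E]

theorem norm_sq_sum_smul {v : ℕ → H} {s : Finset ℕ}
    (hv : ∀ i ∈ s, ∀ j ∈ s, inner ℝ (v i) (v j) = if i = j then (1 : ℝ) else 0) (a : ℕ → ℝ) :
    ‖∑ i ∈ s, a i • v i‖ ^ 2 = ∑ i ∈ s, a i ^ 2 := by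
  rw [← real_inner_self_eq_norm_sq, sum_inner]
  refine Finset.sum_congr rfl fun i hi => ?_
  rw [inner_sum, Finset.sum_eq_single i]
  · rw [inner_smul_left, inner_smul_right, hv i hi i hi]; simp [sq]
  · intro j hj hij
    rw [inner_smul_left, inner_smul_right, hv i hi j hj, if_neg hij.symm]; simp
  · exact fun h => absurd hi h

theorem norm_sq_sub_sum_inner_smul {v : ℕ → H} {s : Finset ℕ}
    (hv : ∀ i ∈ s, ∀ j ∈ s, inner ℝ (v i) (v j) = if i = j then (1 : ℝ) else 0) (x : H) :
    ‖x - ∑ i ∈ s, inner ℝ (v i) x • v i‖ ^ 2 = ‖x‖ ^ 2 - ∑ i ∈ s, inner ℝ (v i) x ^ 2 := by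
  rw [norm_sub_sq_real, norm_sq_sum_smul hv, inner_sum]
  have : ∑ i ∈ s, inner ℝ x (inner ℝ (v i) x • v i) = ∑ i ∈ s, inner ℝ (v i) x ^ 2 := by
    refine Finset.sum_congr rfl fun i _ => ?_
    rw [inner_smul_right, real_inner_comm x, sq]
  rw [this]; ring

theorem sum_inner_sq_le {v : ℕ → H} {s : Finset ℕ}
    (hv : ∀ i ∈ s, ∀ j ∈ s, inner ℝ (v i) (v j) = if i = j then (1 : ℝ) else 0) (x : H) :
    ∑ i ∈ s, inner ℝ (v i) x ^ 2 ≤ ‖x‖ ^ 2 := by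
  have := norm_sq_sub_sum_inner_smul hv x
  nlinarith [sq_nonneg ‖x - ∑ i ∈ s, inner ℝ (v i) x • v i‖]

theorem norm_sum_smul_inner_le {v : ℕ → H} {s : Finset ℕ}
    (hv : ∀ i ∈ s, ∀ j ∈ s, inner ℝ (v i) (v j) = if i = j then (1 : ℝ) else 0)
    {a : ℕ → ℝ} {b : ℝ} (hb : 0 ≤ b) (ha : ∀ i ∈ s, |a i| ≤ b) (x : H) :
    ‖∑ i ∈ s, (a i * inner ℝ (v i) x) • v i‖ ≤ b * ‖x‖ := by
  refine (pow_le_pow_iff_left₀ (by positivity) (by positivity) two_ne_zero).1 ?_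
  rw [norm_sq_sum_smul hv, mul_pow]
  calc ∑ i ∈ s, (a i * inner ℝ (v i) x) ^ 2 ≤ ∑ i ∈ s, b ^ 2 * inner ℝ (v i) x ^ 2 := by
        refine Finset.sum_le_sum fun i hi => ?_
        rw [mul_pow]
        gcongr ?_ * _
        exact sq_le_sq' (by linarith [(abs_le.1 (ha i hi)).1]) (abs_le.1 (ha i hi)).2
    _ = b ^ 2 * ∑ i ∈ s, inner ℝ (v i) x ^ 2 := by rw [Finset.mul_sum]
    _ ≤ b ^ 2 * ‖x‖ ^ 2 := by gcongr; exact sum_inner_sq_le hv x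

theorem empCov_apply (n : ℕ) (y : ℤ → E) (x : ℤ → H) (z : H) :
    empCov n y x z = (n : ℝ)⁻¹ • ∑ k ∈ Finset.Icc 1 n, inner ℝ (x (k : ℤ)) z • y (k : ℤ) := by
  simp [empCov]

/-- The empirical covariance operator has finite rank, so that the ordered eigenvalues vanish from
some index on. -/
theorem IsEigensystem.exists_rank {n : ℕ} {x : ℤ → H} {lam : ℕ → ℝ} {v : ℕ → H}
    (h : IsEigensystem (empCov n x x) lam v) :
    ∃ N, (∀ i < N, lam i ≠ 0) ∧ ∀ i, N ≤ i → lam i = 0 := by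
  let R : Submodule ℝ H := Submodule.span ℝ ((fun k : ℕ => x (k : ℤ)) '' (Finset.Icc 1 n : Set ℕ))
  have : FiniteDimensional ℝ R :=
    FiniteDimensional.span_of_finite ℝ ((Finset.finite_toSet _).image _)
  have hR : ∀ z, empCov n x x z ∈ R := by
    intro z
    rw [empCov_apply]
    refine R.smul_mem _ (R.sum_mem fun k hk => R.smul_mem _ (Submodule.subset_span ?_))
    exact ⟨k, by simpa using hk, rfl⟩
  have hv : ∀ i : {i : ℕ // lam i ≠ 0}, v i ∈ R := by
    rintro ⟨i, hi⟩
    have := R.smul_mem (lam i)⁻¹ (hR (v i))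
    rwa [h.eigen, smul_smul, inv_mul_cancel₀ hi, one_smul] at this
  have hli : LinearIndependent ℝ (fun i : {i : ℕ // lam i ≠ 0} => (⟨v i, hv i⟩ : R)) :=
    LinearIndependent.of_comp R.subtype h.orthonormal.linearIndependent
  have hfin : Finite {i : ℕ // lam i ≠ 0} := hli.finite
  have hex : ∃ i, lam i = 0 := by
    by_contra! hne
    have : Set.Finite {i : ℕ | lam i ≠ 0} := hfin
    exact Set.infinite_univ (this.subset (fun i _ => hne i))
  classical
  refine ⟨Nat.find hex, fun i hi => Nat.find_min hex hi, fun i hi => ?_⟩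
  exact le_antisymm ((h.antitone hi).trans (Nat.find_spec hex).le) (h.nonneg i)

theorem IsEigensystem.inner_eq {C : H →L[ℝ] H} {lam : ℕ → ℝ} {v : ℕ → H}
    (h : IsEigensystem C lam v) {s : Finset ℕ} (hs : ∀ i ∈ s, lam i ≠ 0) :
    ∀ i ∈ s, ∀ j ∈ s, inner ℝ (v i) (v j) = if i = j then (1 : ℝ) else 0 := by
  intro i hi j hj
  have := orthonormal_iff_ite.1 h.orthonormal ⟨i, hs i hi⟩ ⟨j, hs j hj⟩
  simpa using this

/-- Finite rank makes the set in the definition of `truncation` bounded, so its supremum is a genuine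
maximum and not the value `0` that `sSup` takes on unbounded sets. -/
theorem IsEigensystem.inv_le_iff_lt_truncation {n : ℕ} {x : ℤ → H} {lam : ℕ → ℝ} {v : ℕ → H}
    (h : IsEigensystem (empCov n x x) lam v) {m : ℝ} (hm : 0 < m) (i : ℕ) :
    m⁻¹ ≤ lam i ↔ i < truncation m lam := by
  obtain ⟨N, -, hN⟩ := h.exists_rank
  have hbdd : BddAbove {j : ℕ | ∃ i, j = i + 1 ∧ m⁻¹ ≤ lam i} := by
    refine ⟨N, ?_⟩
    rintro _ ⟨i, rfl, hi⟩
    by_contra! hlt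
    rw [hN i (by omega)] at hi
    exact absurd hi (not_le.2 (inv_pos.2 hm))
  constructor
  · intro hi
    exact Nat.lt_of_succ_le (le_csSup hbdd ⟨i, rfl, hi⟩)
  · intro hi
    have hne : {j : ℕ | ∃ i, j = i + 1 ∧ m⁻¹ ≤ lam i}.Nonempty := by
      by_contra hemp
      rw [Set.not_nonempty_iff_eq_empty] at hemp
      simp [truncation, hemp] at hi
    obtain ⟨k, hk, hk'⟩ := Nat.sSup_mem hne hbdd
    refine hk'.trans (h.antitone ?_)
    rw [truncation, hk] at hi
    omega

/-- Deterministic bound for the prediction error at `z`. With `Cₙ = empCov n x x`, the spectral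
projection `P` and the truncated inverse `Q` at level `m⁻¹`, the estimator is `ρ ∘ P + empCov n ε x ∘ Q`
with `‖Q‖ ≤ m`. The bias is controlled without any convergence of eigenvectors: `1 - P` is a
contraction and `‖(1 - P) (Cₙ u)‖ ≤ m⁻¹ ‖u‖`, so it is small at each `z` near some `Cₙ u`. The point `c`
stands for the limit of `Cₙ u`. -/
theorem norm_estimator_sub_le {n : ℕ} {x : ℤ → H} {lam : ℕ → ℝ} {v : ℕ → H}
    (h : IsEigensystem (empCov n x x) lam v) {m : ℝ} (hm : 0 < m) (ρ : H →L[ℝ] E)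
    (y ε : ℤ → E) (hy : ∀ k, y k = ρ (x k) + ε k) {B : ℝ}
    (hB : ∀ q, ‖empCov n ε x q‖ ≤ B * ‖q‖) (hB0 : 0 ≤ B) (z u c : H) :
    ‖estimator n y x m lam v z - ρ z‖ ≤
      ‖ρ‖ * (‖z - c‖ + ‖empCov n x x u - c‖ + m⁻¹ * ‖u‖) + B * (m * ‖z‖) := by
  obtain ⟨N, hN0, hN⟩ := h.exists_rank
  set T := truncation m lam with hT
  have hTle : ∀ i, i < T → m⁻¹ ≤ lam i := fun i hi => (h.inv_le_iff_lt_truncation hm i).2 hi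
  have hm' : 0 < m⁻¹ := inv_pos.2 hm
  have hTpos : ∀ i ∈ Finset.range T, lam i ≠ 0 := fun i hi =>
    (hm'.trans_le (hTle i (Finset.mem_range.1 hi))).ne'
  have hNpos : ∀ i ∈ Finset.range N, lam i ≠ 0 := fun i hi => hN0 i (Finset.mem_range.1 hi)
  have hTN : T ≤ N := by
    by_contra! hlt
    exact hTpos N (Finset.mem_range.2 hlt) (hN N le_rfl)
  have hsub : Finset.range T ⊆ Finset.range N := Finset.range_subset_range.2 hTN
  have hoT := h.inner_eq hTpos
  have hoN := h.inner_eq hNpos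
  set C := empCov n x x with hC
  let P : H → H := fun z => ∑ i ∈ Finset.range T, inner ℝ (v i) z • v i
  let Q : H → H := fun z => ∑ i ∈ Finset.range T, ((lam i)⁻¹ * inner ℝ (v i) z) • v i
  have hPsub : ∀ a b, P (a - b) = P a - P b := fun a b => by
    simp only [P, inner_sub_right, sub_smul, Finset.sum_sub_distrib]
  have hcov : ∀ q, empCov n y x q = ρ (C q) + empCov n ε x q := by
    intro q
    simp only [hC, empCov_apply, hy, map_smul, map_sum, smul_add, Finset.sum_add_distrib]
  have hdec : estimator n y x m lam v z = ρ (P z) + empCov n ε x (Q z) := by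
    have : estimator n y x m lam v z = empCov n y x (Q z) := by
      simp only [estimator, Q, map_sum, _root_.sum_apply, map_smul, ← hT]
      refine Finset.sum_congr rfl fun i _ => ?_
      simp [mul_smul]
    rw [this, hcov]
    congr 2
    simp only [Q, P, map_sum, map_smul, h.eigen, smul_smul]
    refine Finset.sum_congr rfl fun i hi => ?_
    congr 1
    have := hTpos i hi
    field_simp
  have hQ : ‖Q z‖ ≤ m * ‖z‖ := by
    refine norm_sum_smul_inner_le hoT hm.le (fun i hi => ?_) z
    have h1 := hTle i (Finset.mem_range.1 hi)
    rw [abs_of_nonneg (inv_nonneg.2 (h.nonneg i))]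
    exact inv_le_of_inv_le₀ hm h1
  have hIP : ∀ a, ‖a - P a‖ ≤ ‖a‖ := by
    intro a
    refine (pow_le_pow_iff_left₀ (by positivity) (by positivity) two_ne_zero).1 ?_
    rw [norm_sq_sub_sum_inner_smul hoT]
    have : 0 ≤ ∑ i ∈ Finset.range T, inner ℝ (v i) a ^ 2 := Finset.sum_nonneg fun _ _ => sq_nonneg _
    linarith
  have hCsum : C u = ∑ i ∈ Finset.range N, (lam i * inner ℝ (v i) u) • v i := by
    refine (h.expansion u).unique (hasSum_sum_of_ne_finset_zero fun i hi => ?_)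
    rw [hN i (by simpa using hi)]; simp
  have hPC : C u - P (C u) = ∑ i ∈ Finset.range N \ Finset.range T,
      (lam i * inner ℝ (v i) u) • v i := by
    have : P (C u) = ∑ i ∈ Finset.range T, (lam i * inner ℝ (v i) u) • v i := by
      refine Finset.sum_congr rfl fun i hi => ?_
      congr 1
      rw [hCsum, inner_sum, Finset.sum_eq_single i]
      · rw [inner_smul_right, hoT i hi i hi]; simp
      · intro j hj hji
        rw [inner_smul_right, hoN i (hsub hi) j hj, if_neg hji.symm, mul_zero]
      · exact fun hi' => absurd (hsub hi) hi'
    rw [this, hCsum, ← Finset.sum_sdiff hsub]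
    abel
  have hIPC : ‖C u - P (C u)‖ ≤ m⁻¹ * ‖u‖ := by
    rw [hPC]
    refine norm_sum_smul_inner_le (h.inner_eq fun i hi => hNpos i (Finset.mem_sdiff.1 hi).1)
      hm'.le (fun i hi => ?_) u
    rw [abs_of_nonneg (h.nonneg i)]
    have := (Finset.mem_sdiff.1 hi).2
    rw [Finset.mem_range, ← h.inv_le_iff_lt_truncation hm i, not_le] at this
    exact this.le
  have hz : ‖z - P z‖ ≤ ‖z - c‖ + ‖C u - c‖ + m⁻¹ * ‖u‖ := by
    have e : z - P z = ((z - C u) - P (z - C u)) + (C u - P (C u)) := by rw [hPsub]; abel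
    have h1 : ‖z - C u‖ ≤ ‖z - c‖ + ‖C u - c‖ := by
      rw [← norm_sub_rev c (C u)]; exact norm_sub_le_norm_sub_add_norm_sub z c (C u)
    rw [e]
    linarith [norm_add_le ((z - C u) - P (z - C u)) (C u - P (C u)), hIP (z - C u)]
  have e : estimator n y x m lam v z - ρ z = - ρ (z - P z) + empCov n ε x (Q z) := by
    rw [hdec, map_sub]; abel
  rw [e]
  calc ‖-ρ (z - P z) + empCov n ε x (Q z)‖ ≤ ‖ρ (z - P z)‖ + ‖empCov n ε x (Q z)‖ := by
        rw [← norm_neg (ρ (z - P z))]; exact norm_add_le _ _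
    _ ≤ ‖ρ‖ * ‖z - P z‖ + B * ‖Q z‖ := add_le_add (ρ.le_opNorm _) (hB _)
    _ ≤ _ := by gcongr

end Spectral

/-! ### Variances of sums with summable autocovariances -/

section Variance

variable {Ω H : Type*} [MeasurableSpace Ω] [NormedAddCommGroup H] [InnerProductSpace ℝ H]
  {μ : Measure Ω}

theorem integrable_inner_of_memLp_two {f g : Ω → H} (hf : MemLp f 2 μ) (hg : MemLp g 2 μ) :
    Integrable (fun ω => inner ℝ (f ω) (g ω)) μ := by
  have := L2.integrable_inner (𝕜 := ℝ) (hf.toLp f) (hg.toLp g)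
  refine this.congr ?_
  filter_upwards [hf.coeFn_toLp, hg.coeFn_toLp] with ω h1 h2
  rw [h1, h2]

theorem abs_integral_inner_le {f g : Ω → H} (hf : MemLp f 2 μ) (hg : MemLp g 2 μ) :
    |∫ ω, inner ℝ (f ω) (g ω) ∂μ| ≤ (eLpNorm f 2 μ).toReal * (eLpNorm g 2 μ).toReal := by
  have h := abs_real_inner_le_norm (hf.toLp f) (hg.toLp g)
  rw [Lp.norm_toLp, Lp.norm_toLp, L2.inner_def] at h
  refine le_of_eq_of_le ?_ h
  congr 1
  refine integral_congr_ae ?_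
  filter_upwards [hf.coeFn_toLp, hg.coeFn_toLp] with ω h1 h2
  rw [h1, h2]

/-- Summable autocovariances give a variance of linear order. This is used both for the
martingale differences formed with the errors and for the weakly dependent covariates. -/
theorem integral_norm_sq_sum_le {W : ℕ → Ω → H} (hW : ∀ i, MemLp (W i) 2 μ) {c : ℕ → ℝ} {B : ℝ}
    (hc : ∀ i d, |∫ ω, inner ℝ (W (i + d) ω) (W i ω) ∂μ| ≤ c d)
    (hB : ∀ n, ∑ d ∈ Finset.range n, c d ≤ B) (n : ℕ) :
    ∫ ω, ‖∑ i ∈ Finset.range n, W i ω‖ ^ 2 ∂μ ≤ 2 * n * B := by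
  have hc0 : ∀ d, 0 ≤ c d := fun d => (abs_nonneg _).trans (hc 0 d)
  induction n with
  | zero => simp
  | succ n ih =>
    have hS : MemLp (fun ω => ∑ i ∈ Finset.range n, W i ω) 2 μ :=
      memLp_finsetSum _ fun i _ => hW i
    have hS2 := (memLp_two_iff_integrable_sq_norm hS.1).1 hS
    have hW2 := (memLp_two_iff_integrable_sq_norm (hW n).1).1 (hW n)
    have hin : ∀ i, Integrable (fun ω => inner ℝ (W n ω) (W i ω)) μ := fun i =>
      integrable_inner_of_memLp_two (hW n) (hW i)
    have e : ∀ ω, ‖∑ i ∈ Finset.range (n + 1), W i ω‖ ^ 2 =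
        (‖∑ i ∈ Finset.range n, W i ω‖ ^ 2 + 2 * ∑ i ∈ Finset.range n, inner ℝ (W n ω) (W i ω)) +
          ‖W n ω‖ ^ 2 := by
      intro ω
      rw [Finset.sum_range_succ, norm_add_sq_real, sum_inner]
      simp only [real_inner_comm (W n ω)]
    have hi : Integrable (fun ω => ∑ i ∈ Finset.range n, inner ℝ (W n ω) (W i ω)) μ :=
      integrable_finsetSum _ fun i _ => hin i
    simp only [e]
    have hS2i : Integrable (fun ω => ‖∑ i ∈ Finset.range n, W i ω‖ ^ 2 +
        2 * ∑ i ∈ Finset.range n, inner ℝ (W n ω) (W i ω)) μ := hS2.add (hi.const_mul 2)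
    rw [integral_add hS2i hW2, integral_add hS2 (hi.const_mul 2),
      integral_const_mul, integral_finsetSum _ fun i _ => hin i]
    have h1 : ∑ i ∈ Finset.range n, ∫ ω, inner ℝ (W n ω) (W i ω) ∂μ ≤
        ∑ d ∈ Finset.range n, c (d + 1) := by
      rw [← Finset.sum_range_reflect]
      refine Finset.sum_le_sum fun i hi => ?_
      have hi' := Finset.mem_range.1 hi
      have := (abs_le.1 (hc (n - 1 - i) (i + 1))).2
      rwa [show n - 1 - i + (i + 1) = n by omega] at this
    have h2 : ∫ ω, ‖W n ω‖ ^ 2 ∂μ ≤ c 0 := by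
      have := (abs_le.1 (hc n 0)).2
      simpa [real_inner_self_eq_norm_sq] using this
    have h3 := hB (n + 1)
    rw [Finset.sum_range_succ'] at h3
    have h4 := hc0 0
    push_cast
    linarith

end Variance

/-! ### Dyadic chaining -/

section Chaining

variable {H : Type*} [NormedAddCommGroup H]

/-- Chaining along a dyadic grid: if `D j` bounds the increments over neighbouring points of level
`j`, each point of level `J` is reached from `0` by at most one increment of each level. -/
theorem norm_dyadic_le {z : ℝ → H} {D : ℕ → ℝ} (J : ℕ)
    (hD : ∀ j ≤ J, ∀ i < 2 ^ j, ‖z (((i + 1 : ℕ) : ℝ) / 2 ^ j) - z ((i : ℝ) / 2 ^ j)‖ ≤ D j) :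
    ∀ i : ℕ, i ≤ 2 ^ J → ‖z ((i : ℝ) / 2 ^ J)‖ ≤ ‖z 0‖ + ∑ j ∈ Finset.range (J + 1), D j := by
  induction J with
  | zero =>
    intro i hi
    have h0 := hD 0 le_rfl 0 (by norm_num)
    simp only [zero_add, Nat.cast_one, pow_zero, div_one, Nat.cast_zero] at h0
    have : 0 ≤ D 0 := (norm_nonneg _).trans h0
    simp only [pow_zero, div_one, zero_add, Finset.range_one, Finset.sum_singleton] at hi ⊢
    interval_cases i
    · simpa using this
    · have := norm_sub_norm_le (z 1) (z 0)
      simp only [Nat.cast_one]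
      linarith
  | succ J ih =>
    have ih' := ih fun j hj => hD j (hj.trans (Nat.le_succ J))
    have hDJ := hD (J + 1) le_rfl
    have hpos : 0 ≤ D (J + 1) := (norm_nonneg _).trans (hDJ 0 (by positivity))
    have hev : ∀ i : ℕ, ((2 * i : ℕ) : ℝ) / 2 ^ (J + 1) = (i : ℝ) / 2 ^ J := by
      intro i
      push_cast
      rw [pow_succ]; field_simp
    intro i hi
    rw [Finset.sum_range_succ]
    rcases Nat.even_or_odd' i with ⟨k, rfl | rfl⟩
    · rw [hev]
      have := ih' k (by rw [pow_succ] at hi; omega)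
      linarith
    · have h1 := hDJ (2 * k) (by omega)
      have h2 := ih' k (by rw [pow_succ] at hi; omega)
      rw [hev] at h1
      have := norm_sub_norm_le (z (((2 * k + 1 : ℕ) : ℝ) / 2 ^ (J + 1))) (z ((k : ℝ) / 2 ^ J))
      linarith

/-- The weights of the chaining bound sum up to the order `n ^ (-α / 2)`. For `α < 1 / 2` they grow
with the scale, but a factor `2 ^ (j (1 - α) / 2)` can be absorbed into `n ^ ((1 - α) / 2)` since
`2 ^ j ≤ n`, and the remaining weights `2 ^ (-j α / 2)` form a convergent geometric series. -/
theorem sum_chaining_weights_le {α : ℝ} (hα0 : 0 < α) (hα1 : α ≤ 1) {n J : ℕ} (hn : 1 ≤ n)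
    (hJ : 2 ^ J ≤ n) :
    ∑ j ∈ Finset.range (J + 1), ((2 : ℝ) ^ j) ^ (1 / 2 - α) * (n : ℝ) ^ (-(1 / 2) : ℝ) ≤
      (1 - (2 : ℝ) ^ (-(α / 2)))⁻¹ * (n : ℝ) ^ (-(α / 2)) := by
  have hn0 : (0 : ℝ) < n := by exact_mod_cast hn
  set r : ℝ := (2 : ℝ) ^ (-(α / 2)) with hr
  have hr0 : 0 ≤ r := by positivity
  have hr1 : r < 1 := Real.rpow_lt_one_of_one_lt_of_neg (by norm_num) (by linarith)
  calc _ ≤ ∑ j ∈ Finset.range (J + 1), r ^ j * (n : ℝ) ^ (-(α / 2)) := by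
        refine Finset.sum_le_sum fun j hj => ?_
        have hj' : (2 : ℝ) ^ j ≤ n := by
          have : 2 ^ j ≤ n := (Nat.pow_le_pow_right (by norm_num)
            (Nat.lt_succ_iff.1 (Finset.mem_range.1 hj))).trans hJ
          exact_mod_cast this
        have e1 : ((2 : ℝ) ^ j) ^ (1 / 2 - α) = r ^ j * ((2 : ℝ) ^ j) ^ ((1 - α) / 2) := by
          rw [show (1 / 2 - α) = -(α / 2) + (1 - α) / 2 by ring, Real.rpow_add (by positivity), hr,
            ← Real.rpow_natCast_mul (by norm_num), ← Real.rpow_mul_natCast (by norm_num)]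
          ring_nf
        have e2 : (n : ℝ) ^ (-(α / 2)) = (n : ℝ) ^ ((1 - α) / 2) * (n : ℝ) ^ (-(1 / 2) : ℝ) := by
          rw [← Real.rpow_add hn0]; ring_nf
        rw [e1, e2, mul_assoc]
        gcongr
    _ = (∑ j ∈ Finset.range (J + 1), r ^ j) * (n : ℝ) ^ (-(α / 2)) := by rw [Finset.sum_mul]
    _ ≤ _ := by
        gcongr
        rw [← tsum_geometric_of_lt_one hr0 hr1]
        exact (summable_geometric_of_lt_one hr0 hr1).sum_le_tsum _ fun i _ => by positivity

theorem two_pow_rpow_neg_le {α : ℝ} (hα0 : 0 < α) (hα1 : α ≤ 1) {n J : ℕ} (hn : 1 ≤ n)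
    (hJ : n < 2 ^ (J + 1)) :
    ((2 : ℝ) ^ J)⁻¹ ^ α ≤ 2 * (n : ℝ) ^ (-(α / 2)) := by
  have hn0 : (0 : ℝ) < n := by exact_mod_cast hn
  have hn1 : (1 : ℝ) ≤ n := by exact_mod_cast hn
  have h : ((2 : ℝ) ^ J)⁻¹ ≤ 2 * (n : ℝ)⁻¹ := by
    have : (n : ℝ) < 2 ^ (J + 1) := by exact_mod_cast hJ
    rw [pow_succ] at this
    rw [← div_eq_mul_inv, inv_eq_one_div, div_le_div_iff₀ (by positivity) hn0]
    linarith
  calc ((2 : ℝ) ^ J)⁻¹ ^ α ≤ (2 * (n : ℝ)⁻¹) ^ α := by gcongr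
    _ = 2 ^ α * (n : ℝ) ^ (-α) := by
        rw [Real.mul_rpow (by norm_num) (by positivity), Real.inv_rpow hn0.le, Real.rpow_neg hn0.le]
    _ ≤ 2 * (n : ℝ) ^ (-(α / 2)) := by
        gcongr
        · calc (2 : ℝ) ^ α ≤ 2 ^ (1 : ℝ) := Real.rpow_le_rpow_of_exponent_le (by norm_num) hα1
            _ = 2 := Real.rpow_one 2
        · linarith

end Chaining

/-! ### The Hölder seminorm as a random variable -/

section Holder

/-- The Hölder seminorm of order `α`, possibly infinite. The diagonal contributes `0 / 0 ^ α = 0`. -/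
noncomputable def holderSeminorm (α : ℝ) (x : C01) : ENNReal :=
  ⨆ p : unitInterval × unitInterval, ENNReal.ofReal (|x p.1 - x p.2| / |(p.1 : ℝ) - p.2| ^ α)

/-- A supremum of continuous functions is lower semicontinuous, even though it is taken over
uncountably many pairs of points. -/
theorem measurable_holderSeminorm (α : ℝ) : Measurable (holderSeminorm α) := by
  refine LowerSemicontinuous.measurable (lowerSemicontinuous_iSup fun p => ?_)
  refine Continuous.lowerSemicontinuous (ENNReal.continuous_ofReal.comp ?_)
  fun_prop

theorem abs_sub_le_holderSeminorm {α : ℝ} {x : C01} (hx : holderSeminorm α x ≠ ⊤)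
    (s t : unitInterval) :
    |x s - x t| ≤ (holderSeminorm α x).toReal * |(s : ℝ) - t| ^ α := by
  rcases eq_or_ne s t with rfl | hst
  · simp only [sub_self, abs_zero]
    positivity
  · have hpos : 0 < |(s : ℝ) - t| ^ α :=
      Real.rpow_pos_of_pos (abs_pos.2 (sub_ne_zero.2 fun h => hst (Subtype.ext h))) _
    rw [← div_le_iff₀ hpos, ← ENNReal.ofReal_le_iff_le_toReal hx]
    exact le_iSup (fun p : unitInterval × unitInterval =>
      ENNReal.ofReal (|x p.1 - x p.2| / |(p.1 : ℝ) - p.2| ^ α)) (s, t)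

theorem holderSeminorm_le {α M : ℝ} {x : C01}
    (h : ∀ s t : unitInterval, s ≠ t → |x t - x s| < M * |(t : ℝ) - s| ^ α) :
    holderSeminorm α x ≤ ENNReal.ofReal M := by
  refine iSup_le fun p => ?_
  rcases eq_or_ne p.2 p.1 with hst | hst
  · simp [hst]
  · have hpos : 0 < |(p.1 : ℝ) - p.2| ^ α :=
      Real.rpow_pos_of_pos (abs_pos.2 (sub_ne_zero.2 fun h => hst (Subtype.ext h.symm))) _
    exact ENNReal.ofReal_le_ofReal ((div_le_iff₀ hpos).2 (h _ _ hst).le)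

end Holder

/-! ### The cross-covariance operator of errors and covariates -/

section Noise

theorem indepFun_error_covariate {Ω H : Type*} [MeasurableSpace Ω] [MeasurableSpace H]
    {μ : Measure Ω} {X : ℤ → Ω → H} {ε : ℤ → Ω → C01}
    (hεX : ∀ k : ℤ, IndepFun (ε k)
      (fun ω => ((fun j : {j : ℤ // j ≤ k} => X j ω), (fun j : {j : ℤ // j < k} => ε j ω))) μ)
    (k : ℤ) : IndepFun (ε k) (X k) μ := by
  have hψ : Measurable (fun p : ({j : ℤ // j ≤ k} → H) × ({j : ℤ // j < k} → C01) =>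
      p.1 ⟨k, le_rfl⟩) := (measurable_pi_apply _).comp measurable_fst
  exact (hεX k).comp measurable_id hψ

variable {Ω H : Type*} [MeasurableSpace Ω] [NormedAddCommGroup H] [InnerProductSpace ℝ H]

/-- The mean `n⁻¹ ∑_{k=1}^n w_k x_k`. -/
noncomputable def weightedMean (n : ℕ) (w : ℤ → ℝ) (x : ℤ → H) : H :=
  (n : ℝ)⁻¹ • ∑ k ∈ Finset.Icc 1 n, w (k : ℤ) • x (k : ℤ)

theorem sum_Icc_eq_sum_range {M : Type*} [AddCommMonoid M] (n : ℕ) (g : ℤ → M) :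
    ∑ k ∈ Finset.Icc 1 n, g (k : ℤ) = ∑ i ∈ Finset.range n, g ((i : ℤ) + 1) := by
  rw [Finset.range_eq_Ico, ← Finset.Ico_succ_right_eq_Icc]
  have := Finset.sum_Ico_add' (fun k : ℕ => g (k : ℤ)) 0 n 1
  simp only [Nat.cast_add, Nat.cast_one, zero_add] at this
  rw [this]; rfl

theorem weightedMean_sub (n : ℕ) (w w' : ℤ → ℝ) (x : ℤ → H) :
    weightedMean n w x - weightedMean n w' x = weightedMean n (fun k => w k - w' k) x := by
  simp only [weightedMean, ← smul_sub, ← Finset.sum_sub_distrib, sub_smul]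

theorem norm_weightedMean_le (n : ℕ) (w : ℤ → ℝ) (x : ℤ → H) :
    ‖weightedMean n w x‖ ≤ (n : ℝ)⁻¹ * ∑ k ∈ Finset.Icc 1 n, |w (k : ℤ)| * ‖x (k : ℤ)‖ := by
  rw [weightedMean, norm_smul, Real.norm_of_nonneg (by positivity)]
  gcongr
  refine (norm_sum_le _ _).trans_eq ?_
  simp [norm_smul]

/-- At each `t`, the functional `q ↦ empCov n y x q t` is the inner product with a weighted mean of
the covariates, so that the operator norm is at most the supremum over `t` of the norms of these
means. -/
theorem norm_empCov_apply_le {n : ℕ} {y : ℤ → C01} {x : ℤ → H} {B : ℝ} (hB0 : 0 ≤ B)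
    (hB : ∀ t, ‖weightedMean n (fun k => y k t) x‖ ≤ B) (q : H) :
    ‖empCov n y x q‖ ≤ B * ‖q‖ := by
  refine (ContinuousMap.norm_le _ (by positivity)).2 fun t => ?_
  have : empCov n y x q t = inner ℝ (weightedMean n (fun k => y k t) x) q := by
    simp [empCov_apply, weightedMean, inner_smul_left, sum_inner, mul_comm]
  rw [this]
  exact (norm_inner_le_norm _ _).trans (by gcongr; exact hB t)

variable [MeasurableSpace H] [BorelSpace H] {μ : Measure Ω} {X : ℤ → Ω → H} {ε : ℤ → Ω → C01}

/-- The second moment factorizes because `ε_k` and `X_k` are independent. -/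
theorem integral_norm_sq_smul_error_le [IsProbabilityMeasure μ] (hX : ∀ k, Measurable (X k))
    (hε : ∀ k, Measurable (ε k)) (hind : ∀ k, IndepFun (ε k) (X k) μ)
    (hεid : ∀ k, IdentDistrib (ε k) (ε 0) μ μ) {V : ℝ} (hV : ∀ k, ∫ ω, ‖X k ω‖ ^ 2 ∂μ ≤ V)
    (a : C01 →L[ℝ] ℝ) (k : ℤ) :
    ∫ ω, ‖a (ε k ω) • X k ω‖ ^ 2 ∂μ ≤ (∫ ω, a (ε 0 ω) ^ 2 ∂μ) * V := by
  have ha2 : Measurable (fun y => a y ^ 2) := (a.continuous.pow 2).measurable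
  have h3 : IndepFun (fun ω => a (ε k ω) ^ 2) (fun ω => ‖X k ω‖ ^ 2) μ :=
    (hind k).comp (φ := fun y => a y ^ 2) (ψ := fun x => ‖x‖ ^ 2) ha2 (measurable_norm.pow_const 2)
  have := h3.integral_fun_mul_eq_mul_integral (ha2.comp (hε k)).aestronglyMeasurable
    ((hX k).norm.pow_const 2).aestronglyMeasurable
  have e : ∫ ω, ‖a (ε k ω) • X k ω‖ ^ 2 ∂μ = ∫ ω, a (ε k ω) ^ 2 * ‖X k ω‖ ^ 2 ∂μ := by
    simp [norm_smul, mul_pow]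
  have hint : ∫ ω, a (ε k ω) ^ 2 ∂μ = ∫ ω, a (ε 0 ω) ^ 2 ∂μ := ((hεid k).comp ha2).integral_eq
  rw [e, this, hint]
  have : 0 ≤ ∫ ω, a (ε 0 ω) ^ 2 ∂μ := integral_nonneg fun ω => sq_nonneg _
  exact mul_le_mul_of_nonneg_left (hV k) this

variable [SecondCountableTopology H]

theorem memLp_smul_error [IsProbabilityMeasure μ] (hX : ∀ k, Measurable (X k))
    (hε : ∀ k, Measurable (ε k)) (hX2 : ∀ k, MemLp (X k) 2 μ) (hε2 : ∀ k, MemLp (ε k) 2 μ)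
    (hind : ∀ k, IndepFun (ε k) (X k) μ) (a : C01 →L[ℝ] ℝ) (k : ℤ) :
    MemLp (fun ω => a (ε k ω) • X k ω) 2 μ := by
  have hm : Measurable (fun ω => a (ε k ω) • X k ω) :=
    (a.continuous.measurable.comp (hε k)).smul (hX k)
  rw [memLp_two_iff_integrable_sq_norm hm.aestronglyMeasurable]
  have h1 : Integrable (fun ω => ‖a (ε k ω)‖ ^ 2) μ :=
    (memLp_two_iff_integrable_sq_norm (a.continuous.measurable.comp (hε k)).aestronglyMeasurable).1
      (a.comp_memLp' (hε2 k))
  have h2 := (memLp_two_iff_integrable_sq_norm (hX k).aestronglyMeasurable).1 (hX2 k)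
  have h3 : IndepFun (fun ω => ‖a (ε k ω)‖ ^ 2) (fun ω => ‖X k ω‖ ^ 2) μ :=
    (hind k).comp (φ := fun y => ‖a y‖ ^ 2) (ψ := fun x => ‖x‖ ^ 2)
      (a.continuous.norm.pow 2).measurable (measurable_norm.pow_const 2)
  refine (h3.integrable_mul h1 h2).congr (ae_of_all _ fun ω => ?_)
  simp [norm_smul, mul_pow]

/-- The products `a (ε_k) • X_k` form a martingale difference sequence. -/
theorem integral_inner_smul_error [IsProbabilityMeasure μ] (hX : ∀ k, Measurable (X k))
    (hε : ∀ k, Measurable (ε k)) (hε2 : ∀ k, MemLp (ε k) 2 μ) (hε0 : ∀ k, ∫ ω, ε k ω ∂μ = 0)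
    (hεX : ∀ k : ℤ, IndepFun (ε k)
      (fun ω => ((fun j : {j : ℤ // j ≤ k} => X j ω), (fun j : {j : ℤ // j < k} => ε j ω))) μ)
    (a : C01 →L[ℝ] ℝ) {i l : ℤ} (hil : i < l) :
    ∫ ω, inner ℝ (a (ε l ω) • X l ω) (a (ε i ω) • X i ω) ∂μ = 0 := by
  have hψ : Measurable (fun p : ({j : ℤ // j ≤ l} → H) × ({j : ℤ // j < l} → C01) =>
      a (p.2 ⟨i, hil⟩) * inner ℝ (p.1 ⟨l, le_rfl⟩) (p.1 ⟨i, hil.le⟩)) := by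
    refine Measurable.mul (a.continuous.measurable.comp
      ((measurable_pi_apply _).comp measurable_snd)) (Measurable.inner ?_ ?_)
    · exact (measurable_pi_apply _).comp measurable_fst
    · exact (measurable_pi_apply _).comp measurable_fst
  have h := (hεX l).comp a.continuous.measurable hψ
  have hXε : Measurable (fun ω => a (ε i ω) * inner ℝ (X l ω) (X i ω)) :=
    (a.continuous.measurable.comp (hε i)).mul ((hX l).inner (hX i))
  have := h.integral_fun_mul_eq_mul_integral
    (a.continuous.measurable.comp (hε l)).aestronglyMeasurable hXε.aestronglyMeasurable
  have h0 : ∫ ω, a (ε l ω) ∂μ = 0 := by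
    rw [a.integral_comp_comm ((hε2 l).integrable one_le_two), hε0, map_zero]
  simp only [Function.comp_apply] at this
  rw [h0, zero_mul] at this
  rw [← this]
  refine integral_congr_ae (ae_of_all _ fun ω => ?_)
  simp only [real_inner_smul_left, real_inner_smul_right]
  ring

theorem integral_norm_sq_weightedMean_error_le [IsProbabilityMeasure μ]
    (hX : ∀ k, Measurable (X k))
    (hε : ∀ k, Measurable (ε k)) (hX2 : ∀ k, MemLp (X k) 2 μ) (hε2 : ∀ k, MemLp (ε k) 2 μ)
    (hε0 : ∀ k, ∫ ω, ε k ω ∂μ = 0)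
    (hεX : ∀ k : ℤ, IndepFun (ε k)
      (fun ω => ((fun j : {j : ℤ // j ≤ k} => X j ω), (fun j : {j : ℤ // j < k} => ε j ω))) μ)
    (hεid : ∀ k, IdentDistrib (ε k) (ε 0) μ μ) {V : ℝ} (hV : ∀ k, ∫ ω, ‖X k ω‖ ^ 2 ∂μ ≤ V)
    (a : C01 →L[ℝ] ℝ) {n : ℕ} (hn : 1 ≤ n) :
    MemLp (fun ω => weightedMean n (fun k => a (ε k ω)) (fun k => X k ω)) 2 μ ∧
    ∫ ω, ‖weightedMean n (fun k => a (ε k ω)) (fun k => X k ω)‖ ^ 2 ∂μ ≤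
      2 * V * (∫ ω, a (ε 0 ω) ^ 2 ∂μ) / n := by
  have hn0 : (0 : ℝ) < n := by exact_mod_cast hn
  have hind := indepFun_error_covariate hεX
  have hW : ∀ k : ℤ, MemLp (fun ω => a (ε k ω) • X k ω) 2 μ :=
    memLp_smul_error hX hε hX2 hε2 hind a
  set K := (∫ ω, a (ε 0 ω) ^ 2 ∂μ) * V with hK
  have hK0 : 0 ≤ K := (integral_nonneg fun ω => sq_nonneg _).trans
    (integral_norm_sq_smul_error_le hX hε hind hεid hV a 0)
  refine ⟨(memLp_finsetSum _ fun k _ => hW _).const_smul _, ?_⟩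
  have h := integral_norm_sq_sum_le (W := fun i ω => a (ε (i + 1) ω) • X (i + 1) ω)
    (c := fun d => if d = 0 then K else 0) (B := K) (fun i => hW _) (fun i d => ?_) (fun n => ?_) n
  · have e : ∀ ω, ‖weightedMean n (fun k => a (ε k ω)) (fun k => X k ω)‖ ^ 2 =
        ((n : ℝ)⁻¹) ^ 2 * ‖∑ i ∈ Finset.range n, a (ε (i + 1) ω) • X (i + 1) ω‖ ^ 2 := by
      intro ω
      rw [weightedMean, norm_smul, mul_pow, sum_Icc_eq_sum_range n fun k => a (ε k ω) • X k ω]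
      simp
    simp only [e, integral_const_mul]
    calc _ ≤ ((n : ℝ)⁻¹) ^ 2 * (2 * n * K) := by gcongr
      _ = _ := by rw [hK]; field_simp
  · rcases eq_or_ne d 0 with rfl | hd
    · have := integral_norm_sq_smul_error_le hX hε hind hεid hV a (i + 1)
      simp only [add_zero, real_inner_self_eq_norm_sq, if_true]
      rwa [abs_of_nonneg (integral_nonneg fun ω => sq_nonneg _)]
    · rw [if_neg hd, integral_inner_smul_error hX hε hε2 hε0 hεX a, abs_zero]
      push_cast
      omega
  · rcases n with _ | n
    · simpa using hK0
    · simp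

/-- The operator norm of the cross-covariance operator of errors and covariates has a majorant with
expectation of the order `n ^ (-α / 2)`. Chaining is stopped at the scale `2 ^ J ≤ n < 2 ^ (J + 1)`:
increments over larger scales are controlled by their second moments, those over smaller ones by the
Hölder seminorms. The elementary inequality `x ≤ (x ^ 2 / τ + τ) / 2` reduces first moments of maxima
to sums of second moments. -/
theorem exists_noise_bound [IsProbabilityMeasure μ]
    (hX : ∀ k, Measurable (X k))
    (hε : ∀ k, Measurable (ε k)) (hX2 : ∀ k, MemLp (X k) 2 μ) (hε2 : ∀ k, MemLp (ε k) 2 μ)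
    (hε0 : ∀ k, ∫ ω, ε k ω ∂μ = 0)
    (hεX : ∀ k : ℤ, IndepFun (ε k)
      (fun ω => ((fun j : {j : ℤ // j ≤ k} => X j ω), (fun j : {j : ℤ // j < k} => ε j ω))) μ)
    (hεid : ∀ k, IdentDistrib (ε k) (ε 0) μ μ) {V : ℝ} (hV : ∀ k, ∫ ω, ‖X k ω‖ ^ 2 ∂μ ≤ V)
    {α : ℝ} (hα0 : 0 < α) (hα1 : α ≤ 1) (hHolder : HolderErrors μ X ε α) :
    ∃ D : ℝ, ∀ n : ℕ, 1 ≤ n → ∃ B : Ω → ℝ, (∀ ω, 0 ≤ B ω) ∧ Integrable B μ ∧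
      ∫ ω, B ω ∂μ ≤ D * (n : ℝ) ^ (-(α / 2)) ∧
      ∀ᵐ ω ∂μ, ∀ q, ‖empCov n (fun k => ε k ω) (fun k => X k ω) q‖ ≤ B ω * ‖q‖ := by
  have hV0 : 0 ≤ V := (integral_nonneg fun ω => sq_nonneg _).trans (hV 0)
  obtain ⟨M, hMm, hMpos, -, hM2, hM⟩ := hHolder
  -- the random Hölder constants may be replaced by the Hölder seminorms, which are i.i.d.
  set L : ℤ → Ω → ℝ := fun k ω => (holderSeminorm α (ε k ω)).toReal with hL
  have hLmeas : Measurable (fun y : C01 => (holderSeminorm α y).toReal) :=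
    (measurable_holderSeminorm α).ennreal_toReal
  have hLm : ∀ k, Measurable (L k) := fun k => hLmeas.comp (hε k)
  have hLid : ∀ k, IdentDistrib (L k) (L 0) μ μ := fun k => (hεid k).comp hLmeas
  have hle : ∀ k, ∀ᵐ ω ∂μ, holderSeminorm α (ε k ω) ≤ ENNReal.ofReal (M k ω) := fun k => by
    filter_upwards [hM k] with ω h
    exact holderSeminorm_le h
  have hLM : ∀ k, ∀ᵐ ω ∂μ, L k ω ≤ M k ω := fun k => by
    filter_upwards [hle k] with ω h
    exact (ENNReal.toReal_le_of_le_ofReal (hMpos k ω).le h)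
  have hLHolder : ∀ k, ∀ᵐ ω ∂μ, ∀ s t : unitInterval,
      |ε k ω s - ε k ω t| ≤ L k ω * |(s : ℝ) - t| ^ α := fun k => by
    filter_upwards [hle k] with ω h
    exact abs_sub_le_holderSeminorm (ne_top_of_le_ne_top ENNReal.ofReal_ne_top h)
  have hL0 : ∀ k ω, 0 ≤ L k ω := fun k ω => ENNReal.toReal_nonneg
  have hLsq : ∀ k, Integrable (fun ω => L k ω ^ 2) μ := fun k => by
    refine (hM2 k).mono' ((hLm k).pow_const 2).aestronglyMeasurable ?_
    filter_upwards [hLM k] with ω h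
    rw [Real.norm_of_nonneg (sq_nonneg _)]
    exact pow_le_pow_left₀ (hL0 k ω) h 2
  set l : ℝ := ∫ ω, L 0 ω ^ 2 ∂μ with hl
  have hl0 : 0 ≤ l := integral_nonneg fun ω => sq_nonneg _
  have hlk : ∀ k, ∫ ω, L k ω ^ 2 ∂μ = l := fun k =>
    ((hLid k).comp (measurable_id.pow_const 2)).integral_eq
  -- second moments of the functional mean and of its increments
  have hmean := fun (a : C01 →L[ℝ] ℝ) {n : ℕ} (hn : 1 ≤ n) =>
    integral_norm_sq_weightedMean_error_le hX hε hX2 hε2 hε0 hεX hεid hV a hn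
  let ev : ℝ → C01 →L[ℝ] ℝ := fun s =>
    ContinuousMap.evalCLM ℝ (Set.projIcc (0 : ℝ) 1 zero_le_one s)
  have hev : ∀ s (y : C01), ev s y = y (Set.projIcc (0 : ℝ) 1 zero_le_one s) := fun s y => rfl
  have hproj : ∀ s : ℝ, 0 ≤ s → s ≤ 1 → ((Set.projIcc (0 : ℝ) 1 zero_le_one s : unitInterval) : ℝ) = s :=
    fun s h0 h1 => by rw [Set.projIcc_of_mem zero_le_one ⟨h0, h1⟩]
  have hincr : ∀ s t : ℝ, 0 ≤ s → s ≤ 1 → 0 ≤ t → t ≤ 1 →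
      ∫ ω, (ev t - ev s) (ε 0 ω) ^ 2 ∂μ ≤ l * (|t - s| ^ α) ^ 2 := by
    intro s t hs0 hs1 ht0 ht1
    rw [hl, ← integral_mul_const]
    refine integral_mono_ae ?_ ((hLsq 0).mul_const _) ?_
    · exact MemLp.integrable_sq ((ev t - ev s).comp_memLp' (hε2 0))
    · filter_upwards [hLHolder 0] with ω h
      have h' := h (Set.projIcc (0 : ℝ) 1 zero_le_one t) (Set.projIcc (0 : ℝ) 1 zero_le_one s)
      rw [hproj t ht0 ht1, hproj s hs0 hs1] at h'
      simp only [_root_.sub_apply, hev]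
      rw [← mul_pow, ← sq_abs]
      gcongr
  set K0 : ℝ := 2 * V * ∫ ω, ev 0 (ε 0 ω) ^ 2 ∂μ with hK0
  have hK00 : 0 ≤ K0 := by
    have : 0 ≤ ∫ ω, ev 0 (ε 0 ω) ^ 2 ∂μ := integral_nonneg fun ω => sq_nonneg _
    positivity
  set K : ℝ := 2 * V * l with hK
  have hK0' : 0 ≤ K := by positivity
  refine ⟨(K0 + 1) / 2 + (K + 1) / 2 * (1 - (2 : ℝ) ^ (-(α / 2)))⁻¹ + (l + V), fun n hn => ?_⟩
  have hn0 : (0 : ℝ) < n := by exact_mod_cast hn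
  have hn1 : (1 : ℝ) ≤ n := by exact_mod_cast hn
  set J := Nat.log 2 n with hJdef
  have hJ1 : 2 ^ J ≤ n := Nat.pow_log_le_self 2 (by omega)
  have hJ2 : n < 2 ^ (J + 1) := Nat.lt_pow_succ_log_self (by norm_num) n
  set Z : Ω → ℝ → H := fun ω s => weightedMean n (fun k => ev s (ε k ω)) (fun k => X k ω) with hZ
  have hZsub : ∀ ω s t, Z ω t - Z ω s =
      weightedMean n (fun k => (ev t - ev s) (ε k ω)) (fun k => X k ω) := fun ω s t => by
    simp only [hZ, weightedMean_sub, _root_.sub_apply]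
  set σ : ℝ := (n : ℝ) ^ (-(1 / 2) : ℝ) with hσ
  have hσ0 : 0 < σ := by positivity
  have hσ2 : σ ^ 2 = (n : ℝ)⁻¹ := by
    rw [hσ, ← Real.rpow_mul_natCast hn0.le, ← Real.rpow_neg_one]; norm_num
  set τ : ℕ → ℝ := fun j => ((2 : ℝ) ^ j) ^ (1 / 2 - α) * σ with hτ
  have hτ0 : ∀ j, 0 < τ j := fun j => by positivity
  have hτ2 : ∀ j, τ j ^ 2 = 2 ^ j * ((((2 : ℝ) ^ j)⁻¹) ^ α) ^ 2 * (n : ℝ)⁻¹ := fun j => by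
    rw [hτ]
    simp only
    rw [mul_pow, hσ2, Real.inv_rpow (by positivity), Real.rpow_sub (by positivity), div_pow,
      ← Real.rpow_mul_natCast (by positivity) (1 / 2 : ℝ)]
    norm_num
    exact Or.inl (by field_simp)
  set Δ : ℕ → Ω → ℝ := fun j ω => ∑ i ∈ Finset.range (2 ^ j),
    ‖Z ω (((i + 1 : ℕ) : ℝ) / 2 ^ j) - Z ω ((i : ℝ) / 2 ^ j)‖ ^ 2 with hΔ
  have hincrI : ∀ s t, Integrable (fun ω => ‖Z ω t - Z ω s‖ ^ 2) μ := fun s t => by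
    simp only [hZsub]
    have := (hmean (ev t - ev s) hn).1
    exact (memLp_two_iff_integrable_sq_norm this.1).1 this
  have hΔI : ∀ j, Integrable (Δ j) μ := fun j => integrable_finsetSum _ fun i _ => hincrI _ _
  have hΔE : ∀ j, ∫ ω, Δ j ω ∂μ ≤ K * τ j ^ 2 := fun j => by
    rw [hΔ]
    simp only
    rw [integral_finsetSum _ fun i _ => hincrI _ _]
    have hpow : (0 : ℝ) < 2 ^ j := by positivity
    calc _ ≤ ∑ i ∈ Finset.range (2 ^ j), K * ((((2 : ℝ) ^ j)⁻¹) ^ α) ^ 2 * (n : ℝ)⁻¹ := by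
          refine Finset.sum_le_sum fun i hi => ?_
          have hi' : ((i + 1 : ℕ) : ℝ) ≤ 2 ^ j := by
            exact_mod_cast Nat.succ_le_of_lt (Finset.mem_range.1 hi)
          have hi'' : (i : ℝ) ≤ 2 ^ j := le_trans (by push_cast; linarith) hi'
          simp only [hZsub]
          refine (hmean _ hn).2.trans ?_
          have := hincr ((i : ℝ) / 2 ^ j) (((i + 1 : ℕ) : ℝ) / 2 ^ j) (by positivity)
            ((div_le_one hpow).2 hi'') (by positivity) ((div_le_one hpow).2 hi')
          have e : ((i + 1 : ℕ) : ℝ) / 2 ^ j - (i : ℝ) / 2 ^ j = ((2 : ℝ) ^ j)⁻¹ := by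
            push_cast; field_simp; ring
          rw [e, abs_of_pos (inv_pos.2 hpow)] at this
          rw [hK, div_eq_mul_inv, mul_assoc (2 * V) l]
          gcongr
      _ = K * τ j ^ 2 := by
          rw [Finset.sum_const, Finset.card_range, nsmul_eq_mul, hτ2]
          push_cast
          ring
  set R : Ω → ℝ := fun ω => (((2 : ℝ) ^ J)⁻¹) ^ α *
    ((n : ℝ)⁻¹ * ∑ k ∈ Finset.Icc 1 n, (L (k : ℤ) ω ^ 2 + ‖X (k : ℤ) ω‖ ^ 2) / 2) with hR
  have hX2' : ∀ k, Integrable (fun ω => ‖X k ω‖ ^ 2) μ := fun k =>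
    (memLp_two_iff_integrable_sq_norm (hX k).aestronglyMeasurable).1 (hX2 k)
  have hterm : ∀ k : ℤ, Integrable (fun ω => (L k ω ^ 2 + ‖X k ω‖ ^ 2) / 2) μ := fun k =>
    ((hLsq k).add (hX2' k)).div_const 2
  have hRI : Integrable R μ :=
    ((integrable_finsetSum _ fun k _ => hterm _).const_mul _).const_mul _
  have hRE : ∫ ω, R ω ∂μ ≤ (l + V) * (n : ℝ) ^ (-(α / 2)) := by
    have h1 : (n : ℝ)⁻¹ * ∑ k ∈ Finset.Icc 1 n, ∫ ω, (L (k : ℤ) ω ^ 2 + ‖X (k : ℤ) ω‖ ^ 2) / 2 ∂μ ≤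
        (l + V) / 2 := by
      have : ∑ k ∈ Finset.Icc 1 n, ∫ ω, (L (k : ℤ) ω ^ 2 + ‖X (k : ℤ) ω‖ ^ 2) / 2 ∂μ ≤
          ∑ k ∈ Finset.Icc 1 n, (l + V) / 2 := by
        refine Finset.sum_le_sum fun k _ => ?_
        rw [integral_div, integral_add (hLsq _) (hX2' _), hlk]
        gcongr
        exact hV _
      rw [Finset.sum_const, Nat.card_Icc, nsmul_eq_mul, Nat.add_sub_cancel] at this
      rw [inv_mul_le_iff₀ hn0]
      exact this
    rw [hR]
    simp only
    rw [integral_const_mul, integral_const_mul, integral_finsetSum _ fun k _ => hterm _]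
    have h2 := two_pow_rpow_neg_le hα0 hα1 hn hJ2
    calc _ ≤ (2 * (n : ℝ) ^ (-(α / 2))) * ((l + V) / 2) := by
          refine mul_le_mul h2 h1 ?_ (by positivity)
          refine mul_nonneg (by positivity) (Finset.sum_nonneg fun k _ =>
            integral_nonneg fun ω => by positivity)
      _ = _ := by ring
  have hZ0I : Integrable (fun ω => ‖Z ω 0‖ ^ 2) μ := by
    have := (hmean (ev 0) hn).1
    exact (memLp_two_iff_integrable_sq_norm this.1).1 this
  have hamgm : ∀ x s : ℝ, 0 < s → x ≤ (x ^ 2 / s + s) / 2 := by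
    intro x s hs
    have : x ^ 2 / s + s - 2 * x = (x - s) ^ 2 / s := by field_simp; ring
    have h2 : 0 ≤ (x - s) ^ 2 / s := by positivity
    linarith
  have hΔ0 : ∀ j ω, 0 ≤ Δ j ω := fun j ω => Finset.sum_nonneg fun i _ => sq_nonneg _
  have hR0 : ∀ ω, 0 ≤ R ω := fun ω => by
    refine mul_nonneg (by positivity) (mul_nonneg (by positivity) (Finset.sum_nonneg fun k _ => ?_))
    positivity
  refine ⟨fun ω => (‖Z ω 0‖ ^ 2 / σ + σ) / 2 +
    ∑ j ∈ Finset.range (J + 1), (Δ j ω / τ j + τ j) / 2 + R ω, fun ω => ?_, ?_, ?_, ?_⟩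
  · refine add_nonneg (add_nonneg (by positivity) (Finset.sum_nonneg fun j _ => ?_)) (hR0 ω)
    have := hτ0 j
    have := hΔ0 j ω
    positivity
  · refine ((((hZ0I.div_const _).add (integrable_const _)).div_const _).add
      (integrable_finsetSum _ fun j _ => ?_)).add hRI
    exact (((hΔI j).div_const _).add (integrable_const _)).div_const _
  · have i1 : Integrable (fun ω => (‖Z ω 0‖ ^ 2 / σ + σ) / 2) μ :=
      ((hZ0I.div_const _).add (integrable_const _)).div_const _
    have i2 : ∀ j, Integrable (fun ω => (Δ j ω / τ j + τ j) / 2) μ := fun j =>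
      (((hΔI j).div_const _).add (integrable_const _)).div_const _
    have i3 : Integrable (fun ω => ∑ j ∈ Finset.range (J + 1), (Δ j ω / τ j + τ j) / 2) μ :=
      integrable_finsetSum _ fun j _ => i2 j
    have i4 : Integrable (fun ω => (‖Z ω 0‖ ^ 2 / σ + σ) / 2 +
      ∑ j ∈ Finset.range (J + 1), (Δ j ω / τ j + τ j) / 2) μ := i1.add i3
    rw [integral_add i4 hRI, integral_add i1 i3, integral_finsetSum _ fun j _ => i2 j]
    have b1 : ∫ ω, (‖Z ω 0‖ ^ 2 / σ + σ) / 2 ∂μ ≤ (K0 + 1) / 2 * (n : ℝ) ^ (-(α / 2)) := by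
      rw [integral_div, integral_add (hZ0I.div_const _) (integrable_const _), integral_div]
      simp only [integral_const, probReal_univ, one_smul]
      have h1 : ∫ ω, ‖Z ω 0‖ ^ 2 ∂μ ≤ K0 * σ ^ 2 := by
        rw [hσ2, ← div_eq_mul_inv]; exact (hmean (ev 0) hn).2
      have h2 : (∫ ω, ‖Z ω 0‖ ^ 2 ∂μ) / σ ≤ K0 * σ := by
        rw [div_le_iff₀ hσ0]; linarith
      have h3 : σ ≤ (n : ℝ) ^ (-(α / 2)) := Real.rpow_le_rpow_of_exponent_le hn1 (by linarith)
      calc _ ≤ (K0 + 1) / 2 * σ := by linarith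
        _ ≤ _ := by gcongr
    have b2 : ∑ j ∈ Finset.range (J + 1), ∫ ω, (Δ j ω / τ j + τ j) / 2 ∂μ ≤
        (K + 1) / 2 * ((1 - (2 : ℝ) ^ (-(α / 2)))⁻¹ * (n : ℝ) ^ (-(α / 2))) := by
      calc _ ≤ ∑ j ∈ Finset.range (J + 1), (K + 1) / 2 * τ j := by
            refine Finset.sum_le_sum fun j _ => ?_
            rw [integral_div, integral_add ((hΔI j).div_const _) (integrable_const _), integral_div]
            simp only [integral_const, probReal_univ, one_smul]
            have h2 : (∫ ω, Δ j ω ∂μ) / τ j ≤ K * τ j := by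
              rw [div_le_iff₀ (hτ0 j)]; linarith [hΔE j]
            linarith
        _ = (K + 1) / 2 * ∑ j ∈ Finset.range (J + 1), τ j := by rw [Finset.mul_sum]
        _ ≤ _ := by
            gcongr
            exact sum_chaining_weights_le hα0 hα1 hn hJ1
    linarith
  · have hall : ∀ᵐ ω ∂μ, ∀ k, ∀ s t : unitInterval,
      |ε k ω s - ε k ω t| ≤ L k ω * |(s : ℝ) - t| ^ α := ae_all_iff.2 hLHolder
    filter_upwards [hall] with ω hω
    refine norm_empCov_apply_le ?_ fun t => ?_
    · refine add_nonneg (add_nonneg (by positivity) (Finset.sum_nonneg fun j _ => ?_)) (hR0 ω)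
      have := hτ0 j
      have := hΔ0 j ω
      positivity
    have hpow : (0 : ℝ) < 2 ^ J := by positivity
    -- the largest dyadic point of level `J` below `t`
    set i : ℕ := ⌊(2 : ℝ) ^ J * t⌋₊ with hi
    have ht0 : (0 : ℝ) ≤ t := t.2.1
    have ht1 : (t : ℝ) ≤ 1 := t.2.2
    have hi1 : (i : ℝ) ≤ 2 ^ J * t := Nat.floor_le (by positivity)
    have hi2 : (2 : ℝ) ^ J * t < i + 1 := Nat.lt_floor_add_one _
    have hiJ : i ≤ 2 ^ J := by
      have : (i : ℝ) ≤ 2 ^ J := hi1.trans (mul_le_of_le_one_right hpow.le ht1)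
      exact_mod_cast this
    have hchain := norm_dyadic_le (z := Z ω) (D := fun j => (Δ j ω / τ j + τ j) / 2) J
      (fun j _ i hij => ?_) i hiJ
    · have hit : (i : ℝ) / 2 ^ J ≤ t := by rw [div_le_iff₀ hpow]; linarith
      have hdist : |(t : ℝ) - (i : ℝ) / 2 ^ J| ≤ ((2 : ℝ) ^ J)⁻¹ := by
        rw [abs_of_nonneg (by linarith), sub_le_iff_le_add, inv_eq_one_div, ← add_div,
          le_div_iff₀ hpow]
        linarith
      have hres : ‖Z ω t - Z ω ((i : ℝ) / 2 ^ J)‖ ≤ R ω := by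
        rw [hZsub]
        refine (norm_weightedMean_le _ _ _).trans ?_
        rw [hR]
        simp only
        rw [mul_left_comm, Finset.mul_sum _ _ ((((2 : ℝ) ^ J)⁻¹) ^ α)]
        refine mul_le_mul_of_nonneg_left (Finset.sum_le_sum fun k _ => ?_) (by positivity)
        have h1 := hω k t (Set.projIcc (0 : ℝ) 1 zero_le_one ((i : ℝ) / 2 ^ J))
        rw [hproj _ (by positivity) (hit.trans ht1)] at h1
        have h2 : |(ev t - ev ((i : ℝ) / 2 ^ J)) (ε k ω)| ≤ L k ω * (((2 : ℝ) ^ J)⁻¹) ^ α := by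
          simp only [_root_.sub_apply, hev, Set.projIcc_val]
          refine h1.trans ?_
          have := hL0 k ω
          gcongr
        calc _ ≤ (L k ω * (((2 : ℝ) ^ J)⁻¹) ^ α) * ‖X k ω‖ := by gcongr
          _ = (((2 : ℝ) ^ J)⁻¹) ^ α * (L k ω * ‖X k ω‖) := by ring
          _ ≤ _ := by
              gcongr
              nlinarith [sq_nonneg (L k ω - ‖X k ω‖)]
      have e : weightedMean n (fun k => ε k ω t) (fun k => X k ω) = Z ω t := by
        simp only [hZ, hev, Set.projIcc_val]
      rw [e]
      have h3 := norm_sub_norm_le (Z ω t) (Z ω ((i : ℝ) / 2 ^ J))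
      have h4 := hamgm ‖Z ω 0‖ σ hσ0
      linarith
    · refine (hamgm _ (τ j) (hτ0 j)).trans ?_
      have h1 : ‖Z ω (((i + 1 : ℕ) : ℝ) / 2 ^ j) - Z ω ((i : ℝ) / 2 ^ j)‖ ^ 2 ≤ Δ j ω :=
        Finset.single_le_sum (f := fun i : ℕ =>
          ‖Z ω (((i + 1 : ℕ) : ℝ) / 2 ^ j) - Z ω ((i : ℝ) / 2 ^ j)‖ ^ 2)
          (fun _ _ => sq_nonneg _) (Finset.mem_range.2 hij)
      have := hτ0 j
      exact div_le_div_of_nonneg_right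
        (add_le_add_left (div_le_div_of_nonneg_right h1 this.le) _) two_pos.le

end Noise

/-! ### Products of elements of `L⁴` -/

section Products

variable {H : Type*} [NormedAddCommGroup H] [InnerProductSpace ℝ H]

theorem holderTriple_four_four_two : ENNReal.HolderTriple 4 4 2 := by
  constructor
  have h : (4 : ENNReal)⁻¹ = 2⁻¹ * 2⁻¹ := by
    rw [← ENNReal.mul_inv (by simp) (by simp)]; norm_num
  rw [h, ← mul_add, ENNReal.inv_two_add_inv_two, mul_one]

theorem eLpNorm_inner_smul_le {T : Type*} [MeasurableSpace T] {π : Measure T} {x y : T → H}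
    (hx : AEStronglyMeasurable x π) (hy : AEStronglyMeasurable y π) (u : H) :
    eLpNorm (fun z => inner ℝ (x z) u • y z) 2 π ≤ ‖u‖₊ * eLpNorm x 4 π * eLpNorm y 4 π := by
  have := holderTriple_four_four_two
  refine eLpNorm_le_eLpNorm_mul_eLpNorm_of_nnnorm hx hy (fun a b => inner ℝ a u • b) ‖u‖₊
    (ae_of_all _ fun z => ?_)
  rw [nnnorm_smul, mul_comm ‖u‖₊]
  gcongr
  exact nnnorm_inner_le_nnnorm _ _

theorem memLp_inner_smul {T : Type*} [MeasurableSpace T] {π : Measure T} {x : T → H}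
    (hx : MemLp x 4 π) (u : H) : MemLp (fun z => inner ℝ (x z) u • x z) 2 π := by
  refine ⟨(hx.1.inner aestronglyMeasurable_const).smul hx.1,
    (eLpNorm_inner_smul_le hx.1 hx.1 u).trans_lt ?_⟩
  exact ENNReal.mul_lt_top (ENNReal.mul_lt_top ENNReal.coe_lt_top hx.2) hx.2

end Products

/-! ### Coupling of Bernoulli shifts -/

section Coupling

variable {S : Type*}

/-- The sequence whose first `k` entries are those of `a` and which continues with `b`. -/
def splice (k : ℕ) (a b : ℕ → S) : ℕ → S := fun i => if i < k then a i else b (i - k)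

theorem couple_splice (k : ℕ) (a b a' b' : ℕ → S) :
    couple k (splice k a b) (splice k a' b') = splice k a b' := by
  funext i
  by_cases h : i < k <;> simp [couple, splice, h]

theorem splice_tail (k : ℕ) (a b : ℕ → S) : (fun i => splice k a b (i + k)) = b := by
  funext i
  simp [splice]

variable [MeasurableSpace S]

theorem measurable_splice (k : ℕ) :
    Measurable (fun p : (ℕ → S) × (ℕ → S) => splice k p.1 p.2) := by
  refine measurable_pi_lambda _ fun i => ?_
  by_cases h : i < k
  · simp only [splice, h, if_true]; fun_prop
  · simp only [splice, h, if_false]; fun_prop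

theorem measurable_couple (k : ℕ) :
    Measurable (fun p : (ℕ → S) × (ℕ → S) => couple k p.1 p.2) := by
  refine measurable_pi_lambda _ fun i => ?_
  by_cases h : i < k
  · simp only [couple, h, if_true]; fun_prop
  · simp only [couple, h, if_false]; fun_prop

variable (ν : Measure S) [IsProbabilityMeasure ν]

/-- A Bernoulli sequence followed by another one after `k` entries is again a Bernoulli sequence. -/
theorem measurePreserving_splice (k : ℕ) :
    MeasurePreserving (fun p : (ℕ → S) × (ℕ → S) => splice k p.1 p.2)
      ((Measure.infinitePi fun _ : ℕ => ν).prod (Measure.infinitePi fun _ : ℕ => ν))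
      (Measure.infinitePi fun _ : ℕ => ν) := by
  classical
  refine ⟨measurable_splice k, Measure.eq_infinitePi _ fun s t ht => ?_⟩
  have hpre : (fun p : (ℕ → S) × (ℕ → S) => splice k p.1 p.2) ⁻¹' (Set.pi s t) =
      (Set.pi (s.filter (· < k) : Finset ℕ) t) ×ˢ
        (Set.pi ((s.filter (¬ · < k)).image (· - k) : Finset ℕ) fun i => t (i + k)) := by
    ext p
    simp only [Set.mem_preimage, Set.mem_pi, Finset.mem_coe, Set.mem_prod, Finset.mem_filter,
      Finset.mem_image, splice]
    constructor
    · intro h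
      refine ⟨fun i hi => by simpa [hi.2] using h i hi.1, ?_⟩
      rintro _ ⟨i, hi, rfl⟩
      have := h i hi.1
      rw [if_neg hi.2] at this
      rwa [Nat.sub_add_cancel (not_lt.1 hi.2)]
    · rintro ⟨h1, h2⟩ i hi
      by_cases hik : i < k
      · simpa [hik] using h1 i ⟨hi, hik⟩
      · have := h2 (i - k) ⟨i, ⟨hi, hik⟩, rfl⟩
        rw [Nat.sub_add_cancel (not_lt.1 hik)] at this
        simpa [hik] using this
  rw [Measure.map_apply (measurable_splice k) (.pi s.countable_toSet fun i _ => ht i), hpre,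
    Measure.prod_prod, Measure.infinitePi_pi _ fun i _ => ht i,
    Measure.infinitePi_pi _ fun i _ => ht _, Finset.prod_image,
    ← Finset.prod_filter_mul_prod_filter_not s (· < k)]
  · congr 1
    refine Finset.prod_congr rfl fun i hi => ?_
    rw [Nat.sub_add_cancel (not_lt.1 (Finset.mem_filter.1 hi).2)]
  · intro i hi j hj hij
    have hi' := (Finset.mem_filter.1 (Finset.mem_coe.1 hi)).2
    have hj' := (Finset.mem_filter.1 (Finset.mem_coe.1 hj)).2
    simp only at hij
    omega

/-- The coupled sequence is independent of the part of the original one that it forgets, and both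
are distributed as the original one. -/
theorem measurePreserving_couple_tail (k : ℕ) :
    MeasurePreserving
      (fun z : (ℕ → S) × (ℕ → S) => (couple k z.1 z.2, fun i => z.1 (i + k)))
      ((Measure.infinitePi fun _ : ℕ => ν).prod (Measure.infinitePi fun _ : ℕ => ν))
      ((Measure.infinitePi fun _ : ℕ => ν).prod (Measure.infinitePi fun _ : ℕ => ν)) := by
  set π : Measure (ℕ → S) := Measure.infinitePi fun _ : ℕ => ν with hπ
  have hs : MeasurePreserving (fun p : (ℕ → S) × (ℕ → S) => splice k p.1 p.2) (π.prod π) π :=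
    measurePreserving_splice ν k
  have hss := hs.prod hs
  have hm : Measurable (fun z : (ℕ → S) × (ℕ → S) => (couple k z.1 z.2, fun i => z.1 (i + k))) :=
    (measurable_couple k).prodMk (measurable_pi_lambda _ fun i => by fun_prop)
  refine ⟨hm, ?_⟩
  -- rearrange `((a, b), (a', b'))` to `((a, b'), b)`
  have h1 : MeasurePreserving (Prod.map id Prod.snd :
      ((ℕ → S) × (ℕ → S)) × ((ℕ → S) × (ℕ → S)) → ((ℕ → S) × (ℕ → S)) × (ℕ → S))
      ((π.prod π).prod (π.prod π)) ((π.prod π).prod π) :=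
    (MeasurePreserving.id _).prod measurePreserving_snd
  have h2 := measurePreserving_prodAssoc π π π
  have h3 : MeasurePreserving (Prod.map id Prod.swap :
      (ℕ → S) × ((ℕ → S) × (ℕ → S)) → (ℕ → S) × ((ℕ → S) × (ℕ → S)))
      (π.prod (π.prod π)) (π.prod (π.prod π)) :=
    (MeasurePreserving.id _).prod Measure.measurePreserving_swap
  have h4 := h2.symm MeasurableEquiv.prodAssoc
  have h5 := hs.prod (MeasurePreserving.id π)
  have h6 := h5.comp (h4.comp (h3.comp (h2.comp h1)))
  conv_lhs => rw [← hss.map_eq]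
  rw [Measure.map_map hm hss.measurable]
  refine Eq.trans ?_ h6.map_eq
  congr 1
  funext ⟨⟨a, b⟩, ⟨a', b'⟩⟩
  simp only [Function.comp_apply, Prod.map_apply, couple_splice, splice_tail, id_eq]
  rfl

variable {H : Type*} [NormedAddCommGroup H] [InnerProductSpace ℝ H] [CompleteSpace H] {ν}

/-- An autocovariance of a causal Bernoulli shift is bounded by the coupling distance at the same
lag. -/
theorem abs_integral_inner_shift_le {g : (ℕ → S) → H}
    (hg : MemLp g 2 (Measure.infinitePi fun _ : ℕ => ν))
    (hg0 : ∫ z, g z ∂(Measure.infinitePi fun _ : ℕ => ν) = 0) (k : ℕ) :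
    |∫ z, inner ℝ (g z) (g fun i => z (i + k)) ∂(Measure.infinitePi fun _ : ℕ => ν)| ≤
      (eLpNorm (fun z : (ℕ → S) × (ℕ → S) => g z.1 - g (couple k z.1 z.2)) 2
        ((Measure.infinitePi fun _ : ℕ => ν).prod (Measure.infinitePi fun _ : ℕ => ν))).toReal *
      (eLpNorm g 2 (Measure.infinitePi fun _ : ℕ => ν)).toReal := by
  set π : Measure (ℕ → S) := Measure.infinitePi fun _ : ℕ => ν with hπ
  have hct := measurePreserving_couple_tail ν k
  rw [← hπ] at hct
  have hfst : MeasurePreserving (Prod.fst : (ℕ → S) × (ℕ → S) → (ℕ → S)) (π.prod π) π :=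
    measurePreserving_fst
  have hsnd : MeasurePreserving (Prod.snd : (ℕ → S) × (ℕ → S) → (ℕ → S)) (π.prod π) π :=
    measurePreserving_snd
  have hc := hfst.comp hct
  have ht := hsnd.comp hct
  have g1 : MemLp (fun z : (ℕ → S) × (ℕ → S) => g z.1) 2 (π.prod π) :=
    hg.comp_measurePreserving hfst
  have g2 : MemLp (fun z : (ℕ → S) × (ℕ → S) => g z.2) 2 (π.prod π) :=
    hg.comp_measurePreserving hsnd
  have gc : MemLp (fun z : (ℕ → S) × (ℕ → S) => g (couple k z.1 z.2)) 2 (π.prod π) :=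
    hg.comp_measurePreserving hc
  have gt : MemLp (fun z : (ℕ → S) × (ℕ → S) => g (fun i => z.1 (i + k))) 2 (π.prod π) :=
    hg.comp_measurePreserving ht
  have hzero : ∫ z : (ℕ → S) × (ℕ → S), inner ℝ (g (couple k z.1 z.2)) (g (fun i => z.1 (i + k)))
      ∂(π.prod π) = 0 := by
    have hint := integrable_inner_of_memLp_two g1 g2
    have h := integral_map (φ := fun z : (ℕ → S) × (ℕ → S) =>
      (couple k z.1 z.2, fun i => z.1 (i + k))) (μ := π.prod π)
      (f := fun z => inner ℝ (g z.1) (g z.2)) hct.measurable.aemeasurable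
      (by rw [hct.map_eq]; exact hint.1)
    rw [hct.map_eq] at h
    rw [← h, integral_prod _ hint]
    have hgi : Integrable g π := hg.integrable one_le_two
    simp only [integral_inner hgi, hg0, inner_zero_right, integral_zero]
  have hshift : ∫ z, inner ℝ (g z) (g fun i => z (i + k)) ∂π =
      ∫ z : (ℕ → S) × (ℕ → S), inner ℝ (g z.1) (g (fun i => z.1 (i + k))) ∂(π.prod π) := by
    have hm : AEStronglyMeasurable (fun z => inner ℝ (g z) (g fun i => z (i + k))) π := by
      have htail : MeasurePreserving (fun (z : ℕ → S) i => z (i + k)) π π := by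
        refine ⟨measurable_pi_lambda _ fun i => by fun_prop, ?_⟩
        exact Measure.map_infinitePi_infinitePi_of_inj (P := fun _ : ℕ => ν)
          (add_left_injective k)
      exact hg.1.inner (hg.comp_measurePreserving htail).1
    have h := integral_map (μ := π.prod π) hfst.measurable.aemeasurable
      (f := fun z => inner ℝ (g z) (g fun i => z (i + k))) (by rw [hfst.map_eq]; exact hm)
    rwa [hfst.map_eq] at h
  have e : ∫ z, inner ℝ (g z) (g fun i => z (i + k)) ∂π =
      ∫ z : (ℕ → S) × (ℕ → S), inner ℝ (g z.1 - g (couple k z.1 z.2)) (g (fun i => z.1 (i + k)))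
        ∂(π.prod π) := by
    simp only [inner_sub_left]
    rw [integral_sub (integrable_inner_of_memLp_two g1 gt) (integrable_inner_of_memLp_two gc gt),
      hzero, sub_zero, hshift]
  rw [e]
  refine (abs_integral_inner_le (g1.sub gc) gt).trans_eq ?_
  congr 2
  exact eLpNorm_comp_measurePreserving hg.1 ht

end Coupling

/-! ### Law of large numbers for the empirical covariance operator -/

section LawOfLargeNumbers

variable {Ω H S : Type*} [MeasurableSpace Ω] [MeasurableSpace S]
  {μ : Measure Ω}

theorem measurePreserving_innovations {e : ℤ → Ω → S} (hem : ∀ i, Measurable (e i))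
    (hei : iIndepFun e μ) (hed : ∀ i, IdentDistrib (e i) (e 0) μ μ) (k : ℤ) :
    MeasurePreserving (fun ω (i : ℕ) => e (k - i) ω) μ
      (Measure.infinitePi fun _ : ℕ => μ.map (e 0)) := by
  refine ⟨measurable_pi_lambda _ fun i => hem _, ?_⟩
  have hinj : Function.Injective (fun i : ℕ => k - (i : ℤ)) := fun i j h => by
    simp only [sub_right_inj] at h; exact_mod_cast h
  rw [(hei.precomp hinj).map_fun_eq_infinitePi_map fun i => hem _]
  congr 1
  funext i
  exact (hed _).map_eq

variable [NormedAddCommGroup H] [MeasurableSpace H]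

theorem IsLpMApproximable.identDistrib {p : ENNReal} {X : ℤ → Ω → H}
    (h : IsLpMApproximable S p μ X) (k l : ℤ) : IdentDistrib (X k) (X l) μ μ := by
  obtain ⟨-, e, f, hem, hei, hed, hf, hXf, -⟩ := h
  have key : ∀ k, AEMeasurable (X k) μ ∧
      μ.map (X k) = (Measure.infinitePi fun _ : ℕ => μ.map (e 0)).map f := fun k => by
    have hk := measurePreserving_innovations hem hei hed k
    refine ⟨(hf.comp hk.measurable).aemeasurable.congr (EventuallyEq.symm (hXf k)), ?_⟩
    rw [Measure.map_congr (hXf k), ← hk.map_eq, Measure.map_map hf hk.measurable]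
    rfl
  exact ⟨(key k).1, (key l).1, (key k).2.trans (key l).2.symm⟩

variable [IsProbabilityMeasure μ] [InnerProductSpace ℝ H] [CompleteSpace H] [BorelSpace H]
  [SecondCountableTopology H]

/-- A law of large numbers for the empirical covariance operator at a fixed vector, with the rate
`1 / n` for the mean squared error. The coupling distances of `⟪X_k, u⟫ X_k` in `L²` are summable
since those of `X_k` are summable in `L⁴`. -/
theorem exists_integral_norm_sq_empCov_sub_le {X : ℤ → Ω → H}
    (h : IsLpMApproximable S 4 μ X) (u : H) :
    ∃ D : ℝ, ∀ n : ℕ, 1 ≤ n →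
      MemLp (fun ω => empCov n (fun k => X k ω) (fun k => X k ω) u -
        ∫ ω, inner ℝ (X 0 ω) u • X 0 ω ∂μ) 2 μ ∧
      ∫ ω, ‖empCov n (fun k => X k ω) (fun k => X k ω) u -
        ∫ ω, inner ℝ (X 0 ω) u • X 0 ω ∂μ‖ ^ 2 ∂μ ≤ D / n := by
  obtain ⟨hX4, e, f, hem, hei, hed, hf, hXf, hsum⟩ := h
  have hν : IsProbabilityMeasure (μ.map (e 0)) :=
    Measure.isProbabilityMeasure_map (hem 0).aemeasurable
  set π : Measure (ℕ → S) := Measure.infinitePi fun _ : ℕ => μ.map (e 0) with hπ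
  have hlaw : ∀ k : ℤ, MeasurePreserving (fun ω (i : ℕ) => e (k - i) ω) μ π :=
    measurePreserving_innovations hem hei hed
  have hlaw0 : μ.map (fun ω (i : ℕ) => e (-(i : ℤ)) ω) = π := by
    rw [← (hlaw 0).map_eq]; simp only [zero_sub]
  rw [hlaw0] at hsum
  set c : H := ∫ ω, inner ℝ (X 0 ω) u • X 0 ω ∂μ with hc
  have hf4 : MemLp f 4 π := by
    rw [← (hlaw 0).map_eq, memLp_map_measure_iff hf.aestronglyMeasurable
      (hlaw 0).measurable.aemeasurable]
    exact (hX4 0).ae_eq (hXf 0)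
  set g : (ℕ → S) → H := fun z => inner ℝ (f z) u • f z - c with hg
  have hg2 : MemLp g 2 π := (memLp_inner_smul hf4 u).sub (memLp_const c)
  have hgm : StronglyMeasurable g :=
    ((hf.inner measurable_const).smul hf |>.sub measurable_const).stronglyMeasurable
  have hg0 : ∫ z, g z ∂π = 0 := by
    rw [hg, integral_sub ((memLp_inner_smul hf4 u).integrable one_le_two) (integrable_const c)]
    simp only [integral_const, probReal_univ, one_smul]
    have hm : StronglyMeasurable (fun z => inner ℝ (f z) u • f z) :=
      ((hf.inner measurable_const).smul hf).stronglyMeasurable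
    rw [sub_eq_zero, ← (hlaw 0).map_eq, integral_map (hlaw 0).measurable.aemeasurable
      hm.aestronglyMeasurable, hc]
    refine integral_congr_ae ?_
    filter_upwards [hXf 0] with ω h
    rw [h]
  set W : ℕ → Ω → H := fun i ω => inner ℝ (X (i + 1) ω) u • X (i + 1) ω - c with hW
  have hWg : ∀ i : ℕ, W i =ᵐ[μ] fun ω => g (fun j : ℕ => e ((i : ℤ) + 1 - j) ω) := fun i => by
    filter_upwards [hXf (i + 1)] with ω h
    simp only [hW, hg, h]
  have hW2 : ∀ i, MemLp (W i) 2 μ := fun i =>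
    (memLp_inner_smul (hX4 _) u).sub (memLp_const c)
  set A : ℕ → ENNReal := fun d =>
    eLpNorm (fun z : (ℕ → S) × (ℕ → S) => g z.1 - g (couple d z.1 z.2)) 2 (π.prod π) with hA
  have hfst : MeasurePreserving (Prod.fst : (ℕ → S) × (ℕ → S) → (ℕ → S)) (π.prod π) π :=
    measurePreserving_fst
  have hcpl : ∀ d, MeasurePreserving (fun z : (ℕ → S) × (ℕ → S) => couple d z.1 z.2)
      (π.prod π) π := fun d =>
    hfst.comp (measurePreserving_couple_tail (μ.map (e 0)) d)
  have hAtop : ∀ d, A d ≠ ⊤ := fun d =>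
    ((hg2.comp_measurePreserving hfst).sub (hg2.comp_measurePreserving (hcpl d))).2.ne
  have hcov : ∀ i d : ℕ, |∫ ω, inner ℝ (W (i + d) ω) (W i ω) ∂μ| ≤
      (A d).toReal * (eLpNorm g 2 π).toReal := fun i d => by
    have h1 := abs_integral_inner_shift_le hg2 hg0 d
    refine le_of_eq_of_le ?_ h1
    have hm : StronglyMeasurable (fun z => inner ℝ (g z) (g fun j => z (j + d))) :=
      hgm.inner (hgm.comp_measurable (measurable_pi_lambda _ fun j => by fun_prop))
    rw [← hπ, ← (hlaw ((i + d : ℕ) + 1)).map_eq, integral_map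
      (hlaw _).measurable.aemeasurable hm.aestronglyMeasurable]
    congr 1
    refine integral_congr_ae ?_
    filter_upwards [hWg (i + d), hWg i] with ω h1 h2
    rw [h1, h2]
    congr 2
    funext j
    congr 1
    push_cast
    ring
  -- the coupling distance of the products is controlled by the one of the factors
  set F := eLpNorm f 4 π with hF
  set φ : ℕ → ENNReal := fun d =>
    eLpNorm (fun z : (ℕ → S) × (ℕ → S) => f z.1 - f (couple d z.1 z.2)) 4 (π.prod π) with hφ
  have hAφ : ∀ d, A d ≤ 2 * (‖u‖₊ * F) * φ d := fun d => by
    have m1 : AEStronglyMeasurable (fun z : (ℕ → S) × (ℕ → S) => f z.1) (π.prod π) :=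
      (hf.comp measurable_fst).aestronglyMeasurable
    have m2 : AEStronglyMeasurable (fun z : (ℕ → S) × (ℕ → S) => f (couple d z.1 z.2))
      (π.prod π) := (hf.comp (measurable_couple d)).aestronglyMeasurable
    have n1 : eLpNorm (fun z : (ℕ → S) × (ℕ → S) => f z.1) 4 (π.prod π) = F :=
      eLpNorm_comp_measurePreserving hf.aestronglyMeasurable hfst
    have n2 : eLpNorm (fun z : (ℕ → S) × (ℕ → S) => f (couple d z.1 z.2)) 4 (π.prod π) = F :=
      eLpNorm_comp_measurePreserving hf.aestronglyMeasurable (hcpl d)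
    have e1 : (fun z : (ℕ → S) × (ℕ → S) => g z.1 - g (couple d z.1 z.2)) =
        (fun z => inner ℝ (f z.1) u • (f z.1 - f (couple d z.1 z.2))) +
        (fun z => inner ℝ (f z.1 - f (couple d z.1 z.2)) u • f (couple d z.1 z.2)) := by
      funext z
      simp only [hg, Pi.add_apply, smul_sub, inner_sub_left, sub_smul]
      abel
    have k1 := eLpNorm_inner_smul_le m1 (m1.sub m2) u
    have k2 := eLpNorm_inner_smul_le (m1.sub m2) m2 u
    rw [n1] at k1
    rw [n2] at k2
    simp only [hA]
    rw [e1]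
    refine (eLpNorm_add_le ((m1.inner aestronglyMeasurable_const).smul (m1.sub m2))
      (((m1.sub m2).inner aestronglyMeasurable_const).smul m2) one_le_two).trans ?_
    calc _ ≤ ‖u‖₊ * F * φ d + ‖u‖₊ * φ d * F := add_le_add k1 k2
      _ = _ := by ring
  have hAsum : ∑' d, A (d + 1) ≠ ⊤ := by
    refine ne_top_of_le_ne_top ?_ (ENNReal.tsum_le_tsum fun d => hAφ (d + 1))
    rw [ENNReal.tsum_mul_left]
    exact ENNReal.mul_ne_top (ENNReal.mul_ne_top ENNReal.ofNat_ne_top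
      (ENNReal.mul_ne_top ENNReal.coe_ne_top hf4.2.ne)) hsum.ne
  set G := (eLpNorm g 2 π).toReal with hG
  have hB : ∀ n, ∑ d ∈ Finset.range n, (A d).toReal * G ≤
      ((∑' d, A (d + 1)).toReal + (A 0).toReal) * G := fun n => by
    rw [← Finset.sum_mul]
    gcongr
    calc ∑ d ∈ Finset.range n, (A d).toReal ≤ ∑ d ∈ Finset.range (n + 1), (A d).toReal :=
          Finset.sum_le_sum_of_subset_of_nonneg (Finset.range_subset_range.2 (Nat.le_succ n))
            fun _ _ _ => ENNReal.toReal_nonneg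
      _ = ∑ d ∈ Finset.range n, (A (d + 1)).toReal + (A 0).toReal := Finset.sum_range_succ' _ n
      _ ≤ _ := by
          gcongr
          rw [← ENNReal.toReal_sum fun d _ => hAtop _]
          exact ENNReal.toReal_mono hAsum (ENNReal.sum_le_tsum _)
  set B := ((∑' d, A (d + 1)).toReal + (A 0).toReal) * G with hBdef
  refine ⟨2 * B, fun n hn => ?_⟩
  have hn0 : (0 : ℝ) < n := by exact_mod_cast hn
  have hmean : ∀ ω, empCov n (fun k => X k ω) (fun k => X k ω) u - c =
      (n : ℝ)⁻¹ • ∑ i ∈ Finset.range n, W i ω := fun ω => by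
    rw [empCov_apply, sum_Icc_eq_sum_range n fun k => inner ℝ (X k ω) u • X k ω]
    simp only [hW, Finset.sum_sub_distrib, Finset.sum_const, Finset.card_range, smul_sub]
    rw [← Nat.cast_smul_eq_nsmul ℝ, smul_smul, inv_mul_cancel₀ hn0.ne', one_smul]
  simp only [hmean]
  refine ⟨(memLp_finsetSum _ fun i _ => hW2 i).const_smul _, ?_⟩
  simp only [norm_smul, mul_pow, integral_const_mul]
  have := integral_norm_sq_sum_le hW2 hcov hB n
  rw [Real.norm_of_nonneg (by positivity)]
  calc _ ≤ ((n : ℝ)⁻¹) ^ 2 * (2 * n * B) := by gcongr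
    _ = _ := by field_simp

end LawOfLargeNumbers

/-! ### The range of the covariance operator -/

section CovarianceRange

variable {Ω H : Type*} [MeasurableSpace Ω] [NormedAddCommGroup H] [InnerProductSpace ℝ H]
  [CompleteSpace H] [SecondCountableTopology H] {μ : Measure Ω}

/-- A square integrable random element lies almost surely in the closed range of its (uncentred)
covariance operator `C`: for `u` in the orthogonal complement of the range,
`E ⟪ξ, u⟫ ^ 2 = ⟪C u, u⟫ = 0`. -/
theorem exists_covariance_ae_mem_closure_range {ξ : Ω → H} (hξ : MemLp ξ 2 μ) :
    ∃ C : H →L[ℝ] H, (∀ u, C u = ∫ ω, inner ℝ (ξ ω) u • ξ ω ∂μ) ∧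
      ∀ᵐ ω ∂μ, ξ ω ∈ closure (Set.range C) := by
  have hsq := (memLp_two_iff_integrable_sq_norm hξ.1).1 hξ
  have hbd : ∀ u ω, ‖inner ℝ (ξ ω) u • ξ ω‖ ≤ ‖u‖ * ‖ξ ω‖ ^ 2 := fun u ω => by
    rw [norm_smul, sq, ← mul_assoc, mul_comm ‖u‖]
    gcongr
    exact norm_inner_le_norm _ _
  have hint : ∀ u, Integrable (fun ω => inner ℝ (ξ ω) u • ξ ω) μ := fun u =>
    (hsq.const_mul ‖u‖).mono' ((hξ.1.inner aestronglyMeasurable_const).smul hξ.1)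
      (ae_of_all _ (hbd u))
  let C₀ : H →ₗ[ℝ] H :=
    { toFun := fun u => ∫ ω, inner ℝ (ξ ω) u • ξ ω ∂μ
      map_add' := fun u v => by
        simp only [inner_add_right, add_smul]
        exact integral_add (hint u) (hint v)
      map_smul' := fun r u => by
        simp only [inner_smul_right, mul_smul, RingHom.id_apply]
        exact integral_smul _ _ }
  let C : H →L[ℝ] H := C₀.mkContinuous (∫ ω, ‖ξ ω‖ ^ 2 ∂μ) fun u => by
    rw [mul_comm, ← integral_const_mul]
    exact norm_integral_le_of_norm_le (hsq.const_mul ‖u‖) (ae_of_all _ (hbd u))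
  have hC : ∀ u, C u = ∫ ω, inner ℝ (ξ ω) u • ξ ω ∂μ := fun u => rfl
  refine ⟨C, hC, ?_⟩
  set R : Submodule ℝ H := (C : H →ₗ[ℝ] H).range with hR
  -- `ξ` is orthogonal to each vector of a countable dense subset of the complement of the range
  have horth : ∀ w : Rᗮ, ∀ᵐ ω ∂μ, inner ℝ (ξ ω) (w : H) = 0 := fun w => by
    have h0 : inner ℝ (w : H) (C w) = 0 := by
      rw [real_inner_comm]
      exact (Submodule.mem_orthogonal R w).1 w.2 _ ⟨w, rfl⟩
    have h1 : ∫ ω, inner ℝ (ξ ω) (w : H) ^ 2 ∂μ = 0 := by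
      rw [hC, ← integral_inner (hint w)] at h0
      rw [← h0]
      refine integral_congr_ae (ae_of_all _ fun ω => ?_)
      simp only [inner_smul_right, real_inner_comm (w : H), sq]
    have hint2 : Integrable (fun ω => inner ℝ (ξ ω) (w : H) ^ 2) μ := by
      refine (integrable_inner_of_memLp_two (hξ) hξ).const_mul (‖(w : H)‖ ^ 2) |>.mono'
        ((hξ.1.inner aestronglyMeasurable_const).pow 2) (ae_of_all _ fun ω => ?_)
      rw [Real.norm_of_nonneg (sq_nonneg _), real_inner_self_eq_norm_sq, ← mul_pow, ← sq_abs,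
        mul_comm]
      exact pow_le_pow_left₀ (abs_nonneg _) (abs_real_inner_le_norm _ _) 2
    filter_upwards [(integral_eq_zero_iff_of_nonneg (fun ω => sq_nonneg _) hint2).1 h1] with ω h
    simpa using h
  have hall := ae_all_iff.2 fun n => horth (TopologicalSpace.denseSeq Rᗮ n)
  filter_upwards [hall] with ω h
  have hmem : ξ ω ∈ Rᗮᗮ := by
    rw [Submodule.mem_orthogonal]
    intro w hw
    have hcl : IsClosed {w : Rᗮ | inner ℝ (ξ ω) (w : H) = 0} :=
      isClosed_eq (by fun_prop) continuous_const
    have := (TopologicalSpace.denseRange_denseSeq Rᗮ).induction_on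
      (p := fun w : Rᗮ => inner ℝ (ξ ω) (w : H) = 0) ⟨w, hw⟩ hcl h
    rw [real_inner_comm]; exact this
  rw [Submodule.orthogonal_orthogonal_eq_closure] at hmem
  have hcl : ξ ω ∈ closure (R : Set H) := hmem
  rwa [hR, LinearMap.coe_range] at hcl

/-- Up to small probability, a random element is bounded and close to one of finitely many values
of its covariance operator. -/
theorem exists_finite_approximation {Ω H : Type*} [MeasurableSpace Ω] [NormedAddCommGroup H]
    [InnerProductSpace ℝ H] [SecondCountableTopology H] [MeasurableSpace H] [BorelSpace H]
    {μ : Measure Ω} [IsProbabilityMeasure μ] {ξ : Ω → H} (hξ : Measurable ξ) {C : H →L[ℝ] H}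
    (hC : ∀ᵐ ω ∂μ, ξ ω ∈ closure (Set.range C)) {δ : ℝ} (hδ : 0 < δ) {η : ENNReal} (hη : 0 < η) :
    ∃ (N : ℕ) (d : ℕ → H),
      μ {ω | ¬ (‖ξ ω‖ < N ∧ ∃ j < N, ‖ξ ω - C (d j)‖ < δ)} ≤ η := by
  set d := TopologicalSpace.denseSeq H with hd
  set B : ℕ → Set Ω := fun N => {ω | ¬ (‖ξ ω‖ < N ∧ ∃ j < N, ‖ξ ω - C (d j)‖ < δ)} with hB
  have hmeas : ∀ N, NullMeasurableSet (B N) μ := fun N => by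
    refine MeasurableSet.nullMeasurableSet (MeasurableSet.compl ?_)
    refine MeasurableSet.inter (measurableSet_lt hξ.norm measurable_const) ?_
    have : {ω | ∃ j < N, ‖ξ ω - C (d j)‖ < δ} =
        ⋃ j ∈ Finset.range N, {ω | ‖ξ ω - C (d j)‖ < δ} := by
      ext ω; simp
    change MeasurableSet {ω | ∃ j < N, ‖ξ ω - C (d j)‖ < δ}
    rw [this]
    exact Finset.measurableSet_biUnion _ fun j _ =>
      measurableSet_lt (hξ.sub_const _).norm measurable_const
  have hanti : Antitone B := fun M N hMN ω hω h => by
    obtain ⟨h1, j, hj, h2⟩ := h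
    exact hω ⟨h1.trans_le (by exact_mod_cast hMN), j, hj.trans_le hMN, h2⟩
  have hnull : μ (⋂ N, B N) = 0 := by
    refine measure_mono_null (fun ω hω => ?_) (ae_iff.1 hC)
    intro hmem
    obtain ⟨_, ⟨u, rfl⟩, hu⟩ := Metric.mem_closure_iff.1 hmem δ hδ
    have hopen : IsOpen {u | dist (ξ ω) (C u) < δ} := isOpen_lt (by fun_prop) continuous_const
    obtain ⟨j, hj⟩ := (TopologicalSpace.denseRange_denseSeq H).exists_mem_open hopen ⟨u, hu⟩
    obtain ⟨M, hM⟩ := exists_nat_gt ‖ξ ω‖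
    have hω' := Set.mem_iInter.1 hω (max M (j + 1))
    refine hω' ⟨hM.trans_le (by exact_mod_cast le_max_left _ _), j,
      lt_of_lt_of_le (Nat.lt_succ_self j) (le_max_right _ _), ?_⟩
    rw [← dist_eq_norm]; exact hj
  have ht := tendsto_measure_iInter_atTop hmeas hanti ⟨0, measure_ne_top μ _⟩
  rw [hnull] at ht
  obtain ⟨N, hN⟩ := (ENNReal.tendsto_nhds_zero.1 ht η hη).exists
  exact ⟨N, d, hN⟩

end CovarianceRange

/-! ### Consistency of the predictions -/

section Consistency

/-- A stationary process evaluated at an independent uniformly distributed time has the marginal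
distribution of the process. -/
theorem identDistrib_uniform_time {Ω H : Type*} [MeasurableSpace Ω] [MeasurableSpace H]
    {μ : Measure Ω} [IsProbabilityMeasure μ] {X : ℤ → Ω → H} {Y : ℤ → Ω → C01} (hX : ∀ k, Measurable (X k))
    (hid : ∀ k, IdentDistrib (X k) (X 0) μ μ) {n : ℕ} (hn : 1 ≤ n) {K : Ω → ℕ}
    (hK : Measurable K) (hunif : ∀ k ∈ Finset.Icc 1 n, μ {ω | K ω = k} = (n : ENNReal)⁻¹)
    (hind : IndepFun K (sample Y X n) μ) :
    IdentDistrib (fun ω => X (K ω) ω) (X 0) μ μ := by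
  have hXK : Measurable (fun ω => X (K ω) ω) := by
    have : Measurable (fun p : Ω × ℕ => X (p.2 : ℤ) p.1) :=
      measurable_from_prod_countable_left fun k => hX k
    exact this.comp (measurable_id.prodMk hK)
  have hn0 : (n : ENNReal) ≠ 0 := by exact_mod_cast (by omega : n ≠ 0)
  have hnt : (n : ENNReal) ≠ ⊤ := ENNReal.natCast_ne_top n
  have hKm : ∀ k, MeasurableSet {ω | K ω = k} := fun k => hK (measurableSet_singleton k)
  have hdisj : ∀ s : ℕ → Set Ω, ((Finset.Icc 1 n : Finset ℕ) : Set ℕ).PairwiseDisjoint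
      fun k => {ω | K ω = k} ∩ s k := by
    intro s i _ j _ hij
    refine Set.disjoint_left.2 fun ω h1 h2 => hij ?_
    exact h1.1.symm.trans h2.1
  -- the time lies in `{1, …, n}` almost surely
  have hmem : ∀ᵐ ω ∂μ, K ω ∈ Finset.Icc 1 n := by
    have hone : μ (⋃ k ∈ Finset.Icc 1 n, {ω | K ω = k} ∩ Set.univ) = 1 := by
      rw [measure_biUnion_finset (hdisj fun _ => Set.univ)
        fun k _ => (hKm k).inter .univ]
      simp only [Set.inter_univ]
      rw [Finset.sum_congr rfl hunif, Finset.sum_const, Nat.card_Icc, nsmul_eq_mul,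
        Nat.add_sub_cancel, ENNReal.mul_inv_cancel hn0 hnt]
    have hms : MeasurableSet (⋃ k ∈ Finset.Icc 1 n, {ω | K ω = k} ∩ Set.univ) :=
      Finset.measurableSet_biUnion _ fun k _ => (hKm k).inter .univ
    have := (prob_compl_eq_zero_iff hms).2 hone
    filter_upwards [measure_eq_zero_iff_ae_notMem.1 this] with ω hω
    simpa using hω
  have hindk : ∀ k ∈ Finset.Icc 1 n, IndepFun K (X (k : ℤ)) μ := fun k hk => by
    obtain ⟨hk1, hk2⟩ := Finset.mem_Icc.1 hk
    have hψ : Measurable (fun p : Fin n → C01 × H => (p ⟨k - 1, by omega⟩).2) :=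
      measurable_snd.comp (measurable_pi_apply _)
    have := hind.comp measurable_id hψ
    have e : (fun p : Fin n → C01 × H => (p ⟨k - 1, by omega⟩).2) ∘ sample Y X n = X (k : ℤ) := by
      funext ω
      simp only [Function.comp_apply, sample]
      congr 1
      push_cast [Nat.cast_sub hk1]
      ring
    rwa [e] at this
  refine ⟨hXK.aemeasurable, (hX 0).aemeasurable, Measure.ext fun s hs => ?_⟩
  rw [Measure.map_apply hXK hs, Measure.map_apply (hX 0) hs]
  have hae : ((fun ω => X (K ω) ω) ⁻¹' s : Set Ω) =ᵐ[μ]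
      (⋃ k ∈ Finset.Icc 1 n, {ω | K ω = k} ∩ X (k : ℤ) ⁻¹' s : Set Ω) := by
    filter_upwards [hmem] with ω hω
    refine propext ⟨fun h => ?_, fun h => ?_⟩
    · exact Set.mem_biUnion hω ⟨rfl, h⟩
    · obtain ⟨k, _, hk, h'⟩ := Set.mem_iUnion₂.1 h
      have hk' : K ω = k := hk
      change X (K ω) ω ∈ s
      rw [hk']; exact h'
  rw [measure_congr hae, measure_biUnion_finset (hdisj fun k => X (k : ℤ) ⁻¹' s)
    fun k _ => (hKm k).inter (hX k hs)]
  have hterm : ∀ k ∈ Finset.Icc 1 n, μ ({ω | K ω = k} ∩ X (k : ℤ) ⁻¹' s) =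
      (n : ENNReal)⁻¹ * μ (X 0 ⁻¹' s) := fun k hk => by
    have h1 := (hindk k hk).measure_inter_preimage_eq_mul {k} s (measurableSet_singleton k) hs
    have h2 : K ⁻¹' {k} = {ω | K ω = k} := rfl
    rw [h2] at h1
    rw [h1, hunif k hk, (hid k).measure_mem_eq hs]
  rw [Finset.sum_congr rfl hterm, Finset.sum_const, Nat.card_Icc, nsmul_eq_mul,
    Nat.add_sub_cancel, ← mul_assoc, ENNReal.mul_inv_cancel hn0 hnt, one_mul]

variable {Ω H S : Type*} [MeasurableSpace Ω] [MeasurableSpace S]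
  [NormedAddCommGroup H] [InnerProductSpace ℝ H] [CompleteSpace H]
  [SecondCountableTopology H] [MeasurableSpace H] [BorelSpace H]
  {μ : Measure Ω} [IsProbabilityMeasure μ]

theorem measure_le_ofReal_of_integral_le {f : Ω → ℝ} (hf0 : ∀ ω, 0 ≤ f ω) (hf : Integrable f μ)
    {a b : ℝ} (ha : 0 < a) (hb : ∫ ω, f ω ∂μ ≤ b) :
    μ {ω | a ≤ f ω} ≤ ENNReal.ofReal (b / a) := by
  have h := mul_meas_ge_le_integral_of_nonneg (ae_of_all _ hf0) hf a
  rw [← ofReal_measureReal]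
  refine ENNReal.ofReal_le_ofReal ?_
  rw [le_div_iff₀ ha, mul_comm]
  exact h.trans hb

/-- Consistency of the predictions at any random elements that are distributed as the covariates:
the bound for the prediction error is uniform over bounded sets of points near a finite subset of
the range of the covariance operator, so only the marginal law of the argument matters. -/
theorem tendstoInMeasure_prediction (X : ℤ → Ω → H) (ε Y : ℤ → Ω → C01) (ρ : H →L[ℝ] C01)
    (hX : ∀ k, Measurable (X k)) (hε : ∀ k, Measurable (ε k))
    (hY : ∀ k ω, Y k ω = ρ (X k ω) + ε k ω)
    (hXdep : IsLpMApproximable S 4 μ X)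
    (hεid : ∀ k, IdentDistrib (ε k) (ε 0) μ μ)
    (hε4 : ∀ k, MemLp (ε k) 4 μ)
    (hε0 : ∀ k, ∫ ω, ε k ω ∂μ = 0)
    (hεX : ∀ k : ℤ, IndepFun (ε k)
      (fun ω => ((fun j : {j : ℤ // j ≤ k} => X j ω), (fun j : {j : ℤ // j < k} => ε j ω))) μ)
    (α : ℝ) (hα0 : 0 < α) (hα1 : α ≤ 1) (hHolder : HolderErrors μ X ε α)
    (m : ℕ → ℝ) (hm : Tendsto m atTop atTop)
    (hmo : m =o[atTop] fun n : ℕ => (n : ℝ) ^ (α / 2))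
    (lam : ℕ → Ω → ℕ → ℝ) (v : ℕ → Ω → ℕ → H)
    (heig : ∀ n ω, IsEigensystem
      (empCov n (fun k => X k ω) (fun k => X k ω)) (lam n ω) (v n ω))
    (X' : ℕ → Ω → H) (hX' : ∀ n, 1 ≤ n → IdentDistrib (X' n) (X 0) μ μ) :
    TendstoInMeasure μ (fun n ω =>
      ‖estimator n (fun k => Y k ω) (fun k => X k ω) (m n) (lam n ω) (v n ω) (X' n ω) -
        ρ (X' n ω)‖) atTop (fun _ => 0) := by
  have hX2 : ∀ k, MemLp (X k) 2 μ := fun k => (hXdep.1 k).mono_exponent (by norm_num)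
  have hε2 : ∀ k, MemLp (ε k) 2 μ := fun k => (hε4 k).mono_exponent (by norm_num)
  have hV : ∀ k, ∫ ω, ‖X k ω‖ ^ 2 ∂μ ≤ ∫ ω, ‖X 0 ω‖ ^ 2 ∂μ := fun k =>
    (((hXdep.identDistrib k 0).comp (measurable_norm.pow_const 2)).integral_eq).le
  obtain ⟨D, hD⟩ := exists_noise_bound hX hε hX2 hε2 hε0 hεX hεid hV hα0 hα1 hHolder
  obtain ⟨C, hC, hCr⟩ := exists_covariance_ae_mem_closure_range (hX2 0)
  rw [tendstoInMeasure_iff_norm]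
  intro δ hδ
  rw [ENNReal.tendsto_nhds_zero]
  intro η hη
  have hη2 : 0 < η / 2 := ENNReal.half_pos hη.ne'
  set δ' : ℝ := δ / (6 * (‖ρ‖ + 1)) with hδ'
  have hρ := norm_nonneg ρ
  have hδ'0 : 0 < δ' := by positivity
  have hρδ : ‖ρ‖ * (3 * δ') ≤ δ / 2 := by
    rw [hδ', mul_div_assoc', mul_div_assoc', div_le_div_iff₀ (by positivity) (by positivity)]
    nlinarith
  obtain ⟨N, d, hN⟩ := exists_finite_approximation (hX 0) hCr hδ'0 hη2
  choose Q hQ using fun j => exists_integral_norm_sq_empCov_sub_le hXdep (d j)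
  have hlim1 : Tendsto (fun n : ℕ => ∑ j ∈ Finset.range N, Q j / n / δ' ^ 2) atTop (𝓝 0) := by
    rw [← Finset.sum_const_zero (s := Finset.range N) (M := ℝ)]
    refine tendsto_finsetSum _ fun j _ => ?_
    simpa using (tendsto_const_div_atTop_nhds_zero_nat (Q j)).div_const (δ' ^ 2)
  have hlim2 : Tendsto (fun n : ℕ => D * (n : ℝ) ^ (-(α / 2)) * (m n * N) / (δ / 2)) atTop (𝓝 0) := by
    have h1 := hmo.tendsto_div_nhds_zero
    have h2 := (h1.const_mul (D * N)).div_const (δ / 2)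
    simp only [mul_zero, zero_div] at h2
    refine h2.congr fun n => ?_
    rw [Real.rpow_neg (by positivity)]
    ring
  have hlim := ENNReal.tendsto_ofReal (hlim1.add hlim2)
  simp only [add_zero, ENNReal.ofReal_zero] at hlim
  have hmd : ∀ᶠ n in atTop, ∀ j ∈ Finset.range N, (m n)⁻¹ * ‖d j‖ < δ' := by
    rw [Filter.eventually_all_finset]
    intro j _
    have := (tendsto_inv_atTop_zero.comp hm).mul_const ‖d j‖
    rw [zero_mul] at this
    exact this.eventually_lt_const hδ'0
  filter_upwards [ENNReal.tendsto_nhds_zero.1 hlim (η / 2) hη2, hmd, hm.eventually_gt_atTop 0,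
    eventually_ge_atTop 1] with n hn hmdn hmn hn1
  obtain ⟨B, hB0, hBI, hBE, hB⟩ := hD n hn1
  set E₁ : Set Ω := {ω | ¬ (‖X' n ω‖ < N ∧ ∃ j < N, ‖X' n ω - C (d j)‖ < δ')} with hE₁
  set E₂ : ℕ → Set Ω := fun j => {ω | δ' ^ 2 ≤
    ‖empCov n (fun k => X k ω) (fun k => X k ω) (d j) -
      ∫ ω, inner ℝ (X 0 ω) (d j) • X 0 ω ∂μ‖ ^ 2} with hE₂
  set E₃ : Set Ω := {ω | δ / 2 ≤ B ω * (m n * N)} with hE₃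
  have hN0 : (0 : ℝ) ≤ N := Nat.cast_nonneg N
  have hsub : ({ω | δ ≤ ‖‖estimator n (fun k => Y k ω) (fun k => X k ω) (m n) (lam n ω) (v n ω)
      (X' n ω) - ρ (X' n ω)‖ - 0‖} : Set Ω) ≤ᵐ[μ]
      (E₁ ∪ ((⋃ j ∈ Finset.range N, E₂ j) ∪ E₃) : Set Ω) := by
    filter_upwards [hB] with ω hBω hω
    by_contra hnot
    change ω ∉ (E₁ ∪ ((⋃ j ∈ Finset.range N, E₂ j) ∪ E₃) : Set Ω) at hnot
    simp only [Set.mem_union, not_or, Set.mem_iUnion, not_exists] at hnot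
    obtain ⟨h1, h2, h3⟩ := hnot
    simp only [hE₁, Set.mem_ofPred_eq, not_not] at h1
    obtain ⟨hnorm, j, hj, happ⟩ := h1
    have h2' := h2 j (Finset.mem_range.2 hj)
    simp only [hE₂, Set.mem_ofPred_eq, not_le] at h2'
    rw [← hC] at h2'
    have h2'' := lt_of_pow_lt_pow_left₀ 2 hδ'0.le h2'
    simp only [hE₃, Set.mem_ofPred_eq, not_le] at h3
    have hω' : δ ≤ ‖‖estimator n (fun k => Y k ω) (fun k => X k ω) (m n) (lam n ω) (v n ω)
      (X' n ω) - ρ (X' n ω)‖ - 0‖ := hω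
    rw [sub_zero, norm_norm] at hω'
    have hmain := norm_estimator_sub_le (heig n ω) hmn ρ (fun k => Y k ω) (fun k => ε k ω)
      (fun k => hY k ω) hBω (hB0 ω) (X' n ω) (d j) (C (d j))
    have h4 := hmdn j (Finset.mem_range.2 hj)
    have h5 : ‖ρ‖ * (‖X' n ω - C (d j)‖ + ‖empCov n (fun k => X k ω) (fun k => X k ω) (d j) -
        C (d j)‖ + (m n)⁻¹ * ‖d j‖) ≤ ‖ρ‖ * (3 * δ') :=
      mul_le_mul_of_nonneg_left (by linarith) hρ
    have h6 : B ω * (m n * ‖X' n ω‖) ≤ B ω * (m n * N) := by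
      have := hB0 ω
      gcongr
    linarith
  have hm1 : μ E₁ ≤ η / 2 := by
    have hset : MeasurableSet {x : H | ¬ (‖x‖ < N ∧ ∃ j < N, ‖x - C (d j)‖ < δ')} := by
      have : IsOpen {x : H | ‖x‖ < N ∧ ∃ j < N, ‖x - C (d j)‖ < δ'} := by
        have e : {x : H | ‖x‖ < N ∧ ∃ j < N, ‖x - C (d j)‖ < δ'} =
            {x : H | ‖x‖ < N} ∩ ⋃ j ∈ Finset.range N, {x | ‖x - C (d j)‖ < δ'} := by
          ext x; simp
        rw [e]
        refine (isOpen_lt continuous_norm continuous_const).inter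
          (isOpen_biUnion fun j _ => isOpen_lt (by fun_prop) continuous_const)
      exact this.measurableSet.compl
    exact ((hX' n hn1).measure_mem_eq hset).trans_le hN
  have hm2 : ∀ j, μ (E₂ j) ≤ ENNReal.ofReal (Q j / n / δ' ^ 2) := fun j => by
    obtain ⟨q1, q2⟩ := hQ j n hn1
    exact measure_le_ofReal_of_integral_le (fun ω => sq_nonneg _)
      ((memLp_two_iff_integrable_sq_norm q1.1).1 q1) (by positivity) q2
  have hQ0 : ∀ j, 0 ≤ Q j / n / δ' ^ 2 := fun j =>
    div_nonneg ((integral_nonneg fun ω => sq_nonneg _).trans (hQ j n hn1).2) (by positivity)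
  have hD0 : 0 ≤ D * (n : ℝ) ^ (-(α / 2)) := (integral_nonneg hB0).trans hBE
  have hm3 : μ E₃ ≤ ENNReal.ofReal (D * (n : ℝ) ^ (-(α / 2)) * (m n * N) / (δ / 2)) := by
    refine measure_le_ofReal_of_integral_le (fun ω => ?_) (hBI.mul_const _) (by positivity) ?_
    · have := hB0 ω
      positivity
    · rw [integral_mul_const]
      gcongr
  calc _ ≤ μ (E₁ ∪ ((⋃ j ∈ Finset.range N, E₂ j) ∪ E₃)) := measure_mono_ae hsub
    _ ≤ μ E₁ + (∑ j ∈ Finset.range N, μ (E₂ j) + μ E₃) :=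
        (measure_union_le _ _).trans (add_le_add le_rfl ((measure_union_le _ _).trans
          (add_le_add (measure_biUnion_finset_le _ _) le_rfl)))
    _ ≤ η / 2 + (∑ j ∈ Finset.range N, ENNReal.ofReal (Q j / n / δ' ^ 2) +
          ENNReal.ofReal (D * (n : ℝ) ^ (-(α / 2)) * (m n * N) / (δ / 2))) :=
        add_le_add hm1 (add_le_add (Finset.sum_le_sum fun j _ => hm2 j) hm3)
    _ = η / 2 + ENNReal.ofReal (∑ j ∈ Finset.range N, Q j / n / δ' ^ 2 +
          D * (n : ℝ) ^ (-(α / 2)) * (m n * N) / (δ / 2)) := by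
        rw [ENNReal.ofReal_add (Finset.sum_nonneg fun j _ => hQ0 j) (by positivity),
          ENNReal.ofReal_sum_of_nonneg fun j _ => hQ0 j]
    _ ≤ η / 2 + η / 2 := add_le_add le_rfl hn
    _ = η := ENNReal.add_halves η

end Consistency

end FPCA

theorem propositionp {Ω H S : Type*} [MeasurableSpace Ω] [MeasurableSpace S]
    [NormedAddCommGroup H] [InnerProductSpace ℝ H] [CompleteSpace H]
    [TopologicalSpace.SeparableSpace H] [MeasurableSpace H] [BorelSpace H]
    (μ : Measure Ω) [IsProbabilityMeasure μ]
    -- covariates, errors, responses, regression operator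
    (X : ℤ → Ω → H) (ε Y : ℤ → Ω → FPCA.C01) (ρ : H →L[ℝ] FPCA.C01)
    (hX : ∀ k, Measurable (X k)) (hε : ∀ k, Measurable (ε k))
    (hY : ∀ k ω, Y k ω = ρ (X k ω) + ε k ω)
    -- the covariates are centred and weakly dependent
    (hX0 : ∀ k, ∫ ω, X k ω ∂μ = 0)
    (hXdep : FPCA.IsLpMApproximable S 4 μ X)
    -- the errors are centred, i.i.d., with finite fourth moment
    (hεiid : iIndepFun ε μ ∧ ∀ k, IdentDistrib (ε k) (ε 0) μ μ)
    (hε4 : ∀ k, MemLp (ε k) 4 μ)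
    (hε0 : ∀ k, ∫ ω, ε k ω ∂μ = 0)
    -- each error is independent of present and past covariates and of past errors
    (hεX : ∀ k : ℤ, IndepFun (ε k)
      (fun ω => ((fun j : {j : ℤ // j ≤ k} => X j ω), (fun j : {j : ℤ // j < k} => ε j ω))) μ)
    -- Hölder continuity of the errors
    (α : ℝ) (hα0 : 0 < α) (hα1 : α ≤ 1) (hHolder : FPCA.HolderErrors μ X ε α)
    -- the tuning parameter
    (m : ℕ → ℝ) (hm : Tendsto m atTop atTop)
    (hmo : m =o[atTop] fun n : ℕ => (n : ℝ) ^ (α / 2))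
    -- any choice of ordered empirical eigenvalues with orthonormal eigenvectors
    (lam : ℕ → Ω → ℕ → ℝ) (v : ℕ → Ω → ℕ → H)
    (heig : ∀ n ω, FPCA.IsEigensystem
      (FPCA.empCov n (fun k => X k ω) (fun k => X k ω)) (lam n ω) (v n ω)) :
    FPCA.OutOfSampleConsistent μ Y X ρ
        (fun n ω => FPCA.estimator n (fun k => Y k ω) (fun k => X k ω) (m n) (lam n ω) (v n ω)) ∧
      FPCA.InSampleConsistent μ Y X ρ
        (fun n ω => FPCA.estimator n (fun k => Y k ω) (fun k => X k ω) (m n) (lam n ω) (v n ω)) := by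
  have hsec : SecondCountableTopology H := UniformSpace.secondCountable_of_separable H
  have hid := hXdep.identDistrib
  have key := FPCA.tendstoInMeasure_prediction X ε Y ρ hX hε hY hXdep hεiid.2 hε4 hε0 hεX α hα0 hα1
    hHolder m hm hmo lam v heig
  refine ⟨fun X' _ hX'id _ => key (fun _ => X') fun _ _ => hX'id.trans (hid 1 0),
    fun K hK hunif hind => key (fun n ω => X (K n ω) ω) fun n hn => ?_⟩
  exact FPCA.identDistrib_uniform_time hX (fun k => hid k 0) hn (hK n) (hunif n hn) (hind n)
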